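/- Let $-\infty<a<b<\infty$, $\Omega=(a,b)$ and $0<\alpha<1$. For $\varphi\in C_c^\infty(\Omega)$ (extended by zero) let $${}^{-}D^{\alpha}\varphi(x)=\frac{1}{\Gamma(1-\alpha)}\frac{d}{dx}\int_{-\infty}^{x}\frac{\varphi(y)}{(x-y)^{\alpha}}\,dy,\qquad {}^{+}D^{\alpha}\varphi(x)=-\frac{1}{\Gamma(1-\alpha)}\frac{d}{dx}\int_{x}^{\infty}\frac{\varphi(y)}{(y-x)^{\alpha}}\,dy .$$ For $u\in L^1(\Omega)$, functions $v,w\in L^1_{loc}(\Omega)$ are the left and right weak fractional derivatives ${}^{-}\mathcal D^{\alpha}u$, ${}^{+}\mathcal D^{\alpha}u$ of $u$ if $\int_\Omega v\varphi\,dx=\int_\Omega u\,{}^{+}D^{\alpha}\varphi\,dx$, respectively $\int_\Omega w\varphi\,dx=\int_\Omega u\,{}^{-}D^{\alpha}\varphi\,dx$, for all $\varphi\in C_c^\infty(\Omega)$; the Riesz weak fractional derivative is ${}^{z}\mathcal D^{\alpha}u=\frac12({}^{-}\mathcal D^{\alpha}u+{}^{+}\mathcal D^{\alpha}u)$. A function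 $u\in L^1(\Omega)$ is *Riesz $\alpha$-harmonic* if ${}^{z}\mathcal D^{\alpha}u$ exists, belongs to $L^1(\Omega)$, and ${}^{z}\mathcal D^{\alpha}\,{}^{z}\mathcal D^{\alpha}u=0$ in the distributional sense, i.e. $\int_\Omega {}^{z}\mathcal D^{\alpha}u\cdot\frac12({}^{-}D^{\alpha}\varphi+{}^{+}D^{\alpha}\varphi)\,dx=0$ for all $\varphi\in C_c^\infty(\Omega)$. A *Riesz null function* on $\Omega$ is any function $$\kappa^{\alpha}_z(x)=c_1(x-a)^{\alpha/2}(b-x)^{\alpha/2-1}+c_2(x-a)^{\alpha/2-1}(b-x)^{\alpha/2},\qquad c_1,c_2\in\mathbb R .$$ (i) Every Riesz null function $\kappa^\alpha_z$ on $\Omega$ is Riesz $\alpha$-harmonic. (ii) Let $\Omega=(0,1)$, $2/3<\alpha<1$ and $\rho(x)=x^{\alpha/2}(1-x)^{\alpha/2}$. For every Riesz $\alpha$-harmonic function $u$ there are Riesz null functions $\kappa^\alpha_z$ and $\tilde\kappa^\alpha_z$ on $(0,1)$ such that, for a.e. $x\in(0,1)$, $$u(x)=\rho(x)\sum_{n=0}^{\infty}u_n\,G_n^{(\alpha/2,\alpha/2)}(x)+\tilde\kappa^{\alpha}_z(x),$$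 where the series converges absolutely for a.e. $x$ and also in the weighted space $L^2((0,1),\rho)$, $$u_n=-\frac{\Gamma(n+1)}{\Gamma(n+1+\alpha)}\;\frac{\int_0^1\rho(x)\,\kappa^{\alpha}_z(x)\,G_n^{(\alpha/2,\alpha/2)}(x)\,dx}{\int_0^1\rho(x)\,G_n^{(\alpha/2,\alpha/2)}(x)^2\,dx},$$ and $G_n^{(\alpha/2,\alpha/2)}$ is the Jacobi polynomial $$G_n^{(\alpha/2,\alpha/2)}(x)=\sum_{k=0}^{n}\frac{(-1)^{n+k}\,\Gamma(n+\alpha/2+1)\,\Gamma(n+k+\alpha+1)}{\Gamma(k+1)\,\Gamma(n-k+1)\,\Gamma(n+\alpha+1)\,\Gamma(k+\alpha/2+1)}\,x^k .$$ -/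

import Mathlib

open MeasureTheory Set Filter Topology
open scoped ContDiff

noncomputable section

namespace FracRiesz

/-- Left Riemann-Liouville integral of order `σ > 0` on the line:
`(1 / Γ(σ)) ∫_{-∞}^x (x - y)^(σ - 1) f(y) dy`. -/
def leftRLIntegral (σ : ℝ) (f : ℝ → ℝ) (x : ℝ) : ℝ :=
  (1 / Real.Gamma σ) * ∫ y in Iio x, (x - y) ^ (σ - 1) * f y

/-- Right Riemann-Liouville integral of order `σ > 0` on the line:
`(1 / Γ(σ)) ∫_x^∞ (y - x)^(σ - 1) f(y) dy`. -/
def rightRLIntegral (σ : ℝ) (f : ℝ → ℝ) (x : ℝ) : ℝ :=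
  (1 / Real.Gamma σ) * ∫ y in Ioi x, (y - x) ^ (σ - 1) * f y

/-- Classical left (Riemann-Liouville) derivative of order `0 < α < 1`. It is only applied to
test functions, extended by zero to the line. -/
def leftFracDeriv (α : ℝ) (φ : ℝ → ℝ) (x : ℝ) : ℝ :=
  deriv (leftRLIntegral (1 - α) φ) x

/-- Classical right (Riemann-Liouville) derivative of order `0 < α < 1`. -/
def rightFracDeriv (α : ℝ) (φ : ℝ → ℝ) (x : ℝ) : ℝ :=
  -deriv (rightRLIntegral (1 - α) φ) x

/-- Classical Riesz derivative of a test function: the mean of the left and right derivatives. -/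
def rieszFracDeriv (α : ℝ) (φ : ℝ → ℝ) (x : ℝ) : ℝ :=
  (1 / 2) * (leftFracDeriv α φ x + rightFracDeriv α φ x)

/-- `C_c^∞((a, b))`, its elements being extended by zero to the whole line. -/
structure IsTestFunction (a b : ℝ) (φ : ℝ → ℝ) : Prop where
  smooth : ContDiff ℝ ∞ φ
  compact : HasCompactSupport φ
  support_subset : tsupport φ ⊆ Ioo a b

/-- `v ∈ L^1_loc(a, b)` is the left weak derivative of order `0 < α < 1` of `u ∈ L^1(a, b)`:
`∫ v φ = ∫ u (right derivative of φ)` for all test functions `φ`. (The sign `(-1)^[α]` is `1`.) -/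
structure IsLeftWeakFracDeriv (a b α : ℝ) (u v : ℝ → ℝ) : Prop where
  integrable : IntegrableOn u (Ioo a b)
  locallyIntegrable : LocallyIntegrableOn v (Ioo a b)
  integral_eq : ∀ φ : ℝ → ℝ, IsTestFunction a b φ →
    ∫ x in Ioo a b, v x * φ x = ∫ x in Ioo a b, u x * rightFracDeriv α φ x

/-- `w ∈ L^1_loc(a, b)` is the right weak derivative of order `0 < α < 1` of `u ∈ L^1(a, b)`:
`∫ w φ = ∫ u (left derivative of φ)` for all test functions `φ`. -/
structure IsRightWeakFracDeriv (a b α : ℝ) (u w : ℝ → ℝ) : Prop where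
  integrable : IntegrableOn u (Ioo a b)
  locallyIntegrable : LocallyIntegrableOn w (Ioo a b)
  integral_eq : ∀ φ : ℝ → ℝ, IsTestFunction a b φ →
    ∫ x in Ioo a b, w x * φ x = ∫ x in Ioo a b, u x * leftFracDeriv α φ x

/-- `g` is the Riesz weak derivative of `u`: the mean of its left and right weak derivatives. -/
def IsRieszWeakFracDeriv (a b α : ℝ) (u g : ℝ → ℝ) : Prop :=
  ∃ v w : ℝ → ℝ, IsLeftWeakFracDeriv a b α u v ∧ IsRightWeakFracDeriv a b α u w ∧
    ∀ᵐ x ∂(volume.restrict (Ioo a b)), g x = (1 / 2) * (v x + w x)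

/-- `u ∈ L^1(a, b)` is Riesz `α`-harmonic: its Riesz weak derivative `g` is in `L^1(a, b)`, and the
Riesz derivative of `g` vanishes in the distributional sense. -/
def IsRieszHarmonic (a b α : ℝ) (u : ℝ → ℝ) : Prop :=
  IntegrableOn u (Ioo a b) ∧
    ∃ g : ℝ → ℝ, IntegrableOn g (Ioo a b) ∧ IsRieszWeakFracDeriv a b α u g ∧
      ∀ φ : ℝ → ℝ, IsTestFunction a b φ → ∫ x in Ioo a b, g x * rieszFracDeriv α φ x = 0

/-- The general Riesz null function on `(a, b)`:
`c₁ (x - a)^(α/2) (b - x)^(α/2 - 1) + c₂ (x - a)^(α/2 - 1) (b - x)^(α/2)`. -/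
def rieszNull (a b α c₁ c₂ : ℝ) (x : ℝ) : ℝ :=
  c₁ * ((x - a) ^ (α / 2) * (b - x) ^ (α / 2 - 1)) +
    c₂ * ((x - a) ^ (α / 2 - 1) * (b - x) ^ (α / 2))

/-- The weight `ρ(x) = x^(α/2) (1 - x)^(α/2)` on `(0, 1)`. -/
def jacobiWeight (α x : ℝ) : ℝ :=
  x ^ (α / 2) * (1 - x) ^ (α / 2)

/-- The coefficient `g_{n,k}` of `x^k` in the Jacobi polynomial `G_n^{(α/2, α/2)}`, `k ≤ n`. -/
def jacobiCoeff (α : ℝ) (n k : ℕ) : ℝ :=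
  (-1) ^ (n + k) * Real.Gamma (n + α / 2 + 1) * Real.Gamma (n + k + α + 1) /
    (Real.Gamma (k + 1) * Real.Gamma ((n : ℝ) - (k : ℝ) + 1) * Real.Gamma (n + α + 1) *
      Real.Gamma (k + α / 2 + 1))

/-- The Jacobi polynomial `G_n^{(α/2, α/2)}` of the interval `(0, 1)`. -/
def jacobiG (α : ℝ) (n : ℕ) (x : ℝ) : ℝ :=
  ∑ k ∈ Finset.range (n + 1), jacobiCoeff α n k * x ^ k

/-- The coefficient `u_n` of the series form that belongs to the function `κ`. -/
def seriesCoeff (α : ℝ) (κ : ℝ → ℝ) (n : ℕ) : ℝ :=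
  -(Real.Gamma (n + 1) / Real.Gamma (n + 1 + α)) *
    ((∫ x in Ioo (0 : ℝ) 1, jacobiWeight α x * κ x * jacobiG α n x) /
      ∫ x in Ioo (0 : ℝ) 1, jacobiWeight α x * jacobiG α n x ^ 2)

end FracRiesz

end

/-! Write T for the operator on (a, b) with the odd kernel sgn(t)|t|^(-α). The Riesz derivative of a
test function φ is a constant times T(φ'), and T is antisymmetric, so the weak Riesz derivative of
an integrable f is the same constant times the distributional derivative of Tf. By du Bois-Reymond,
f is annihilated by the Riesz derivative iff Tf is constant a.e.

Two facts make T computable. First, Tw = 0 for w = ((x - a)(b - x))^(α/2 - 1): the Möbius involution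
that fixes x and exchanges a and b carries the integral over (a, x) to the one over (x, b). Second,
there is a ladder: T(y f) = x Tf - If, where I has kernel |t|^(1 - α) and is a primitive of (1 -
α)T. Hence T(yw) is constant. A null function is an affine function times w, so its Riesz derivative
vanishes; this is (i), once the left derivative has been shown to exist through an Euler integral.

On (0, 1) the ladder shows that p ↦ (T(ρp))' maps polynomials to polynomials without raising the
degree, with diagonal entries proportional to Γ(n + 1 + α)/Γ(n + 1). Integration by parts makes this
map symmetric in L²(ρ). A triangular symmetric map is diagonal on the orthogonal polynomials, which
are the G_n, so the Riesz derivative of ρG_n is a multiple of G_n (`exists_potential_jacobiPoly`,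
`integral_jacobiG_mul_rieszFracDeriv`).

The same relation gives uniqueness. If Tf is constant, then testing with ρG_n, n ≥ 1, says that f is
orthogonal to a polynomial of exact degree n + 1; so the first two moments of f determine all the
others, and f is the null function with those two moments (`ae_eq_rieszNull_of_convOn_const`).

For (ii), the Riesz derivative g of u is therefore a null function. Dividing the Jacobi coefficients
of g by the eigenvalues gives a series ρ∑u_nG_n with Riesz derivative g
(`integral_jacobiSeries_mul_rieszFracDeriv`), and u minus the series is annihilated, hence again a
null function. The condition α > 2/3 says that null functions lie in L²(ρ). Together with Γ(n +
1)/Γ(n + 1 + α) ≤ n^(-α), which is square summable, this gives ∑|u_n|‖G_n‖ < ∞, and both modes of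
convergence follow. -/

noncomputable section

namespace FracRiesz

/-! ### Difference kernels on an interval -/

/-- Integral operator on `(a, b)` with the difference kernel `k`. -/
def convOn (k : ℝ → ℝ) (a b : ℝ) (f : ℝ → ℝ) (x : ℝ) : ℝ :=
  ∫ y in Ioo a b, k (x - y) * f y

/-- For x and y in (a, b) the difference stays in [a - b, b - a], so both factors may be cut off to
integrable functions on the line, and the integrand is that of a convolution. -/
theorem integrable_kernel_prod {k f : ℝ → ℝ} {a b : ℝ} (hk : LocallyIntegrable k)
    (hf : IntegrableOn f (Ioo a b)) :
    Integrable (fun p : ℝ × ℝ => k (p.1 - p.2) * f p.2)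
      ((volume.restrict (Ioo a b)).prod (volume.restrict (Ioo a b))) := by
  have hk' : Integrable ((Icc (a - b) (b - a)).indicator k) :=
    (hk.integrableOn_isCompact isCompact_Icc).integrable_indicator measurableSet_Icc
  have hf' : Integrable ((Ioo a b).indicator f) := hf.integrable_indicator measurableSet_Ioo
  have h := Integrable.convolution_integrand (ContinuousLinearMap.mul ℝ ℝ) hf' hk'
  rw [Measure.prod_restrict]
  refine (integrableOn_congr_fun ?_ (measurableSet_Ioo.prod measurableSet_Ioo)).1 h.integrableOn
  rintro ⟨x, y⟩ ⟨hx, hy⟩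
  have h1 : x - y ∈ Icc (a - b) (b - a) := by
    constructor <;> [linarith [hx.1, hy.2]; linarith [hx.2, hy.1]]
  simp only [ContinuousLinearMap.mul_apply']
  rw [indicator_of_mem h1, indicator_of_mem hy, mul_comm]

theorem ae_integrableOn_kernel {k f : ℝ → ℝ} {a b : ℝ} (hk : LocallyIntegrable k)
    (hf : IntegrableOn f (Ioo a b)) :
    ∀ᵐ x ∂(volume.restrict (Ioo a b)), IntegrableOn (fun y => k (x - y) * f y) (Ioo a b) :=
  (integrable_kernel_prod hk hf).prod_right_ae

theorem integrableOn_convOn {k f : ℝ → ℝ} {a b : ℝ} (hk : LocallyIntegrable k)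
    (hf : IntegrableOn f (Ioo a b)) : IntegrableOn (convOn k a b f) (Ioo a b) :=
  (integrable_kernel_prod hk hf).integral_prod_left

/-- Fubini: the transposed operator has the reflected kernel. -/
theorem integral_mul_convOn {k f ψ : ℝ → ℝ} {a b C : ℝ} (hk : LocallyIntegrable k)
    (hf : IntegrableOn f (Ioo a b))
    (hψ : AEStronglyMeasurable ψ (volume.restrict (Ioo a b)))
    (hC : ∀ x ∈ Ioo a b, |ψ x| ≤ C) :
    ∫ x in Ioo a b, ψ x * convOn k a b f x =
      ∫ y in Ioo a b, f y * convOn (fun t => k (-t)) a b ψ y := by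
  have h := integrable_kernel_prod hk hf
  have h2 : Integrable (fun p : ℝ × ℝ => ψ p.1 * (k (p.1 - p.2) * f p.2))
      ((volume.restrict (Ioo a b)).prod (volume.restrict (Ioo a b))) := by
    refine h.bdd_mul (c := C) hψ.comp_fst ?_
    have := (ae_restrict_mem (μ := volume) (measurableSet_Ioo (a := a) (b := b)))
    have h3 := Measure.quasiMeasurePreserving_fst (μ := volume.restrict (Ioo a b))
      (ν := volume.restrict (Ioo a b)) |>.ae this
    filter_upwards [h3] with p hp using hC _ hp
  have e := integral_integral_swap (f := fun x y => ψ x * (k (x - y) * f y)) h2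
  simp only [convOn, ← integral_const_mul]
  rw [e]
  refine integral_congr_ae (ae_of_all _ fun y => integral_congr_ae (ae_of_all _ fun x => ?_))
  simp only [neg_sub]
  ring

theorem convOn_eq_integral {k f : ℝ → ℝ} {a b : ℝ} (hf : ∀ x, x ∉ Ioo a b → f x = 0) (x : ℝ) :
    convOn k a b f x = ∫ y, k (x - y) * f y := by
  refine setIntegral_eq_integral_of_forall_compl_eq_zero fun y hy => ?_
  rw [hf y hy, mul_zero]

theorem convOn_congr_ae {k f g : ℝ → ℝ} {a b : ℝ}
    (h : f =ᵐ[volume.restrict (Ioo a b)] g) : convOn k a b f = convOn k a b g := by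
  funext x
  refine integral_congr_ae ?_
  filter_upwards [h] with y hy
  rw [hy]

theorem convOn_const_mul (k f : ℝ → ℝ) (a b c x : ℝ) :
    convOn k a b (fun y => c * f y) x = c * convOn k a b f x := by
  simp only [convOn, ← integral_const_mul]
  congr 1; funext y; ring

theorem convOn_add_ae {k f g : ℝ → ℝ} {a b : ℝ} (hk : LocallyIntegrable k)
    (hf : IntegrableOn f (Ioo a b)) (hg : IntegrableOn g (Ioo a b)) :
    convOn k a b (fun y => f y + g y) =ᵐ[volume.restrict (Ioo a b)]
      fun x => convOn k a b f x + convOn k a b g x := by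
  filter_upwards [ae_integrableOn_kernel hk hf, ae_integrableOn_kernel hk hg] with x h1 h2
  simp only [convOn]
  rw [← integral_add h1 h2]
  congr 1; funext y; ring

/-- The kernel `t₊ ^ (-α)`. -/
def leftKernel (α : ℝ) : ℝ → ℝ := (Ioi 0).indicator fun t => t ^ (-α)

/-- The kernel `sgn(t) |t| ^ (-α)`. -/
def oddKernel (α t : ℝ) : ℝ := leftKernel α t - leftKernel α (-t)

theorem leftKernel_of_pos {α t : ℝ} (ht : 0 < t) : leftKernel α t = t ^ (-α) :=
  indicator_of_mem (mem_Ioi.2 ht) _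

theorem leftKernel_of_nonpos {α t : ℝ} (ht : t ≤ 0) : leftKernel α t = 0 :=
  indicator_of_notMem (notMem_Ioi.2 ht) _

theorem oddKernel_neg (α t : ℝ) : oddKernel α (-t) = -oddKernel α t := by
  simp [oddKernel]

theorem oddKernel_of_pos {α t : ℝ} (ht : 0 < t) : oddKernel α t = t ^ (-α) := by
  rw [oddKernel, leftKernel_of_pos ht, leftKernel_of_nonpos (by linarith), sub_zero]

theorem oddKernel_of_neg {α t : ℝ} (ht : t < 0) : oddKernel α t = -(-t) ^ (-α) := by
  rw [oddKernel, leftKernel_of_nonpos ht.le, leftKernel_of_pos (by linarith), zero_sub]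

/-- Source of the ladder relation: a factor t turns the singular odd kernel into a continuous even
one. -/
theorem oddKernel_mul_self {α : ℝ} (hα : α < 1) (t : ℝ) : oddKernel α t * t = |t| ^ (1 - α) := by
  rcases lt_trichotomy t 0 with h | rfl | h
  · rw [oddKernel_of_neg h, abs_of_neg h, show (1 - α) = -α + 1 by ring,
      Real.rpow_add_one (by linarith)]
    ring
  · simp [Real.zero_rpow (by linarith : 1 - α ≠ 0)]
  · rw [oddKernel_of_pos h, abs_of_pos h, show (1 - α) = -α + 1 by ring,
      Real.rpow_add_one (by linarith)]

theorem locallyIntegrable_leftKernel {α : ℝ} (hα : α < 1) : LocallyIntegrable (leftKernel α) := by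
  have h : ∀ c d, IntervalIntegrable (fun t : ℝ => t ^ (-α)) volume c d := fun c d =>
    intervalIntegral.intervalIntegrable_rpow' (by linarith)
  intro x
  have hm : Ioo (x - 1) (x + 1) ∈ 𝓝 x := Ioo_mem_nhds (by linarith) (by linarith)
  refine ⟨_, hm, ?_⟩
  have := ((intervalIntegrable_iff_integrableOn_Ioo_of_le (by linarith)).1 (h (x - 1) (x + 1)))
  exact this.indicator measurableSet_Ioi

theorem locallyIntegrable_leftKernel_neg {α : ℝ} (hα : α < 1) :
    LocallyIntegrable fun t => leftKernel α (-t) := by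
  intro x
  obtain ⟨s, hs, hi⟩ := locallyIntegrable_leftKernel hα (-x)
  refine ⟨Neg.neg ⁻¹' s, continuous_neg.continuousAt.preimage_mem_nhds hs, ?_⟩
  exact ((Measure.measurePreserving_neg (volume : Measure ℝ)).integrableOn_comp_preimage
    (MeasurableEquiv.neg ℝ).measurableEmbedding).2 hi

theorem locallyIntegrable_oddKernel {α : ℝ} (hα : α < 1) : LocallyIntegrable (oddKernel α) :=
  (locallyIntegrable_leftKernel hα).sub (locallyIntegrable_leftKernel_neg hα)

theorem continuous_abs_rpow {β : ℝ} (hβ : 0 ≤ β) : Continuous fun t : ℝ => |t| ^ β :=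
  continuous_abs.rpow_const fun _ => Or.inr hβ

theorem integral_mul_convOn_oddKernel {f ψ : ℝ → ℝ} {α a b C : ℝ} (hα : α < 1)
    (hf : IntegrableOn f (Ioo a b))
    (hψ : AEStronglyMeasurable ψ (volume.restrict (Ioo a b)))
    (hC : ∀ x ∈ Ioo a b, |ψ x| ≤ C) :
    ∫ x in Ioo a b, ψ x * convOn (oddKernel α) a b f x =
      -∫ y in Ioo a b, f y * convOn (oddKernel α) a b ψ y := by
  rw [integral_mul_convOn (locallyIntegrable_oddKernel hα) hf hψ hC, ← integral_neg]
  refine integral_congr_ae (ae_of_all _ fun y => ?_)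
  simp only [convOn, oddKernel_neg, neg_mul, integral_neg, mul_neg]

/-- The L¹–L^∞ case of Young's inequality. It makes fractional derivatives of test functions
bounded, so that they can be paired with any integrable function. -/
theorem bounded_convOn {k ψ : ℝ → ℝ} {a b C : ℝ} (hk : LocallyIntegrable k)
    (hC : ∀ x ∈ Ioo a b, |ψ x| ≤ C) :
    ∃ M, ∀ x ∈ Ioo a b, |convOn k a b ψ x| ≤ M := by
  have hk' : IntegrableOn (fun t => |k t|) (Icc (a - b) (b - a)) :=
    (hk.integrableOn_isCompact isCompact_Icc).abs
  refine ⟨(∫ t in Icc (a - b) (b - a), |k t|) * C, fun x hx => ?_⟩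
  have hC0 : 0 ≤ C := (abs_nonneg _).trans (hC x hx)
  have hi : Integrable (fun t => (Icc (a - b) (b - a)).indicator (fun t => |k t|) t) :=
    hk'.integrable_indicator measurableSet_Icc
  calc |convOn k a b ψ x| ≤ ∫ y in Ioo a b,
        (Icc (a - b) (b - a)).indicator (fun t => |k t|) (x - y) * C := by
        change ‖∫ y in Ioo a b, k (x - y) * ψ y‖ ≤ _
        refine norm_integral_le_of_norm_le ((hi.comp_sub_left x).mul_const C).integrableOn ?_
        filter_upwards [ae_restrict_mem measurableSet_Ioo] with y hy
        rw [norm_mul, indicator_of_mem]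
        · exact mul_le_mul_of_nonneg_left (hC y hy) (abs_nonneg _)
        · constructor <;> [linarith [hx.1, hy.2]; linarith [hx.2, hy.1]]
    _ ≤ ∫ y, (Icc (a - b) (b - a)).indicator (fun t => |k t|) (x - y) * C := by
        refine setIntegral_le_integral ((hi.comp_sub_left x).mul_const C) (ae_of_all _ fun y => ?_)
        exact mul_nonneg (indicator_nonneg (fun _ _ => abs_nonneg _) _) hC0
    _ = _ := by
        rw [integral_mul_const, integral_sub_left_eq_self (fun t => (Icc (a - b) (b - a)).indicator
          (fun t => |k t|) t), integral_indicator measurableSet_Icc]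

/-! ### Test functions, their fractional derivatives, and the du Bois-Reymond lemma -/

section TestFunction

variable {a b : ℝ} {φ : ℝ → ℝ}

theorem IsTestFunction.eq_zero (hφ : IsTestFunction a b φ) {x : ℝ} (hx : x ∉ Ioo a b) :
    φ x = 0 :=
  image_eq_zero_of_notMem_tsupport fun h => hx (hφ.support_subset h)

theorem IsTestFunction.deriv_eq_zero (hφ : IsTestFunction a b φ) {x : ℝ} (hx : x ∉ Ioo a b) :
    deriv φ x = 0 :=
  image_eq_zero_of_notMem_tsupport fun h =>
    hx (hφ.support_subset (closure_minimal (support_deriv_subset) (isClosed_tsupport φ) h))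

theorem IsTestFunction.continuous_deriv (hφ : IsTestFunction a b φ) : Continuous (deriv φ) :=
  hφ.smooth.continuous_deriv (by simp)

theorem IsTestFunction.hasDerivAt (hφ : IsTestFunction a b φ) (x : ℝ) :
    HasDerivAt φ (deriv φ x) x :=
  (hφ.smooth.differentiable (by simp) x).hasDerivAt

theorem IsTestFunction.exists_bound (hφ : IsTestFunction a b φ) : ∃ C, ∀ x, |φ x| ≤ C :=
  hφ.compact.exists_bound_of_continuous hφ.smooth.continuous

theorem IsTestFunction.exists_bound_deriv (hφ : IsTestFunction a b φ) :
    ∃ C, ∀ x, |deriv φ x| ≤ C :=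
  hφ.compact.deriv.exists_bound_of_continuous hφ.continuous_deriv

theorem IsTestFunction.integral_deriv (hφ : IsTestFunction a b φ) :
    ∫ x in Ioo a b, deriv φ x = 0 := by
  rw [setIntegral_eq_integral_of_forall_compl_eq_zero fun x hx => hφ.deriv_eq_zero hx]
  exact integral_eq_zero_of_hasDerivAt_of_integrable hφ.hasDerivAt
    (hφ.continuous_deriv.integrable_of_hasCompactSupport hφ.compact.deriv)
    (hφ.smooth.continuous.integrable_of_hasCompactSupport hφ.compact)

/-- Leaves a margin at both ends, so that functions controlled only inside the open interval can be
integrated by parts on a compact one. -/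
theorem IsTestFunction.exists_subinterval (hφ : IsTestFunction a b φ) (hab : a < b) :
    ∃ c d, a < c ∧ c < d ∧ d < b ∧ IsTestFunction c d φ := by
  rcases (tsupport φ).eq_empty_or_nonempty with h | h
  · refine ⟨(2 * a + b) / 3, (a + 2 * b) / 3, by linarith, by linarith, by linarith,
      hφ.smooth, hφ.compact, by simp [h]⟩
  · have hc : IsCompact (tsupport φ) := hφ.compact
    have h1 := hφ.support_subset (hc.sInf_mem h)
    have h2 := hφ.support_subset (hc.sSup_mem h)
    have hle : sInf (tsupport φ) ≤ sSup (tsupport φ) :=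
      csInf_le hc.bddBelow (hc.sSup_mem h)
    refine ⟨(a + sInf (tsupport φ)) / 2, (sSup (tsupport φ) + b) / 2, by linarith [h1.1],
      by linarith [h1.1, h2.2], by linarith [h2.2], hφ.smooth, hφ.compact, fun x hm => ?_⟩
    have h3 := csInf_le hc.bddBelow hm
    have h4 := le_csSup hc.bddAbove hm
    exact ⟨by linarith [h1.1], by linarith [h2.2]⟩

/-- The derivative of a convolution may be put on the smooth factor, so the singularity of the
kernel is never differentiated. -/
theorem hasDerivAt_integral_kernel {k : ℝ → ℝ} (hk : LocallyIntegrable k)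
    (hφ : IsTestFunction a b φ) (x : ℝ) :
    HasDerivAt (fun x => ∫ y, k (x - y) * φ y) (convOn k a b (deriv φ) x) x := by
  have h := hφ.compact.hasDerivAt_convolution_right (ContinuousLinearMap.mul ℝ ℝ) hk
    (hφ.smooth.of_le (by simp)) x
  rw [convolution_eq_swap] at h
  rw [convOn_eq_integral fun x hx => hφ.deriv_eq_zero hx]
  have e : (fun x => ∫ y, k (x - y) * φ y) =
      convolution k φ (ContinuousLinearMap.mul ℝ ℝ) volume := by
    funext z
    rw [convolution_eq_swap]
    rfl
  rw [e]
  exact h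

theorem continuous_convOn_deriv {k : ℝ → ℝ} (hk : LocallyIntegrable k)
    (hφ : IsTestFunction a b φ) : Continuous (convOn k a b (deriv φ)) := by
  have h := hφ.compact.deriv.continuous_convolution_right (ContinuousLinearMap.mul ℝ ℝ) hk
    hφ.continuous_deriv
  convert h using 1
  funext z
  rw [convolution_eq_swap, convOn_eq_integral fun x hx => hφ.deriv_eq_zero hx]
  rfl

theorem leftRLIntegral_eq (α : ℝ) (φ : ℝ → ℝ) (x : ℝ) :
    leftRLIntegral (1 - α) φ x = 1 / Real.Gamma (1 - α) * ∫ y, leftKernel α (x - y) * φ y := by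
  rw [leftRLIntegral, ← integral_indicator measurableSet_Iio]
  congr 2
  funext y
  by_cases h : y < x
  · rw [indicator_of_mem (mem_Iio.2 h), leftKernel_of_pos (by linarith)]
    congr 2; ring
  · rw [indicator_of_notMem (by simpa using h), leftKernel_of_nonpos (by linarith), zero_mul]

theorem rightRLIntegral_eq (α : ℝ) (φ : ℝ → ℝ) (x : ℝ) :
    rightRLIntegral (1 - α) φ x =
      1 / Real.Gamma (1 - α) * ∫ y, leftKernel α (-(x - y)) * φ y := by
  rw [rightRLIntegral, ← integral_indicator measurableSet_Ioi]
  congr 2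
  funext y
  by_cases h : x < y
  · rw [indicator_of_mem (mem_Ioi.2 h), leftKernel_of_pos (by linarith)]
    congr 2 <;> ring
  · rw [indicator_of_notMem (by simpa using h), leftKernel_of_nonpos (by linarith), zero_mul]

theorem leftFracDeriv_eq {α : ℝ} (hα : α < 1) (hφ : IsTestFunction a b φ) (x : ℝ) :
    leftFracDeriv α φ x =
      1 / Real.Gamma (1 - α) * convOn (leftKernel α) a b (deriv φ) x := by
  rw [leftFracDeriv, funext (leftRLIntegral_eq α φ)]
  exact ((hasDerivAt_integral_kernel (locallyIntegrable_leftKernel hα) hφ x).const_mul _).deriv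

theorem rightFracDeriv_eq {α : ℝ} (hα : α < 1) (hφ : IsTestFunction a b φ) (x : ℝ) :
    rightFracDeriv α φ x =
      -(1 / Real.Gamma (1 - α) * convOn (fun t => leftKernel α (-t)) a b (deriv φ) x) := by
  rw [rightFracDeriv, funext (rightRLIntegral_eq α φ)]
  exact congrArg _
    ((hasDerivAt_integral_kernel (locallyIntegrable_leftKernel_neg hα) hφ x).const_mul _).deriv

theorem integrableOn_kernel_deriv {k : ℝ → ℝ} (hk : LocallyIntegrable k)
    (hφ : IsTestFunction a b φ) (x : ℝ) :
    IntegrableOn (fun y => k (x - y) * deriv φ y) (Ioo a b) := by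
  have h := hφ.compact.deriv.convolutionExists_right (ContinuousLinearMap.mul ℝ ℝ) hk
    hφ.continuous_deriv x
  exact h.integrable_swap.integrableOn

theorem rieszFracDeriv_eq {α : ℝ} (hα : α < 1) (hφ : IsTestFunction a b φ) (x : ℝ) :
    rieszFracDeriv α φ x =
      1 / (2 * Real.Gamma (1 - α)) * convOn (oddKernel α) a b (deriv φ) x := by
  rw [rieszFracDeriv, leftFracDeriv_eq hα hφ, rightFracDeriv_eq hα hφ]
  have h : convOn (oddKernel α) a b (deriv φ) x = convOn (leftKernel α) a b (deriv φ) x -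
      convOn (fun t => leftKernel α (-t)) a b (deriv φ) x := by
    simp only [convOn]
    rw [← integral_sub (integrableOn_kernel_deriv (locallyIntegrable_leftKernel hα) hφ x)
      (integrableOn_kernel_deriv (locallyIntegrable_leftKernel_neg hα) hφ x)]
    congr 1; funext y
    rw [oddKernel]; ring
  rw [h]
  have : Real.Gamma (1 - α) ≠ 0 := (Real.Gamma_pos_of_pos (by linarith)).ne'
  field_simp
  ring

theorem rieszFracDeriv_bounded {α : ℝ} (hα : α < 1) (hφ : IsTestFunction a b φ) :
    ∃ M, ∀ x ∈ Ioo a b, |rieszFracDeriv α φ x| ≤ M := by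
  obtain ⟨C, hC⟩ := hφ.exists_bound_deriv
  obtain ⟨M, hM⟩ := bounded_convOn (a := a) (b := b) (locallyIntegrable_oddKernel hα)
    fun x _ => hC x
  refine ⟨|1 / (2 * Real.Gamma (1 - α))| * M, fun x hx => ?_⟩
  rw [rieszFracDeriv_eq hα hφ, abs_mul]
  exact mul_le_mul_of_nonneg_left (hM x hx) (abs_nonneg _)

theorem continuous_rieszFracDeriv {α : ℝ} (hα : α < 1) (hφ : IsTestFunction a b φ) :
    Continuous (rieszFracDeriv α φ) := by
  rw [funext (rieszFracDeriv_eq hα hφ)]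
  exact continuous_const.mul (continuous_convOn_deriv (locallyIntegrable_oddKernel hα) hφ)

/-- The Riesz derivative of `f` tested against `φ` is the distributional derivative of the
potential with the odd kernel. -/
theorem integral_mul_rieszFracDeriv {α : ℝ} (hα : α < 1) (hφ : IsTestFunction a b φ)
    {f : ℝ → ℝ} (hf : IntegrableOn f (Ioo a b)) :
    ∫ x in Ioo a b, f x * rieszFracDeriv α φ x =
      -(1 / (2 * Real.Gamma (1 - α))) *
        ∫ x in Ioo a b, convOn (oddKernel α) a b f x * deriv φ x := by
  obtain ⟨C, hC⟩ := hφ.exists_bound_deriv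
  have h := integral_mul_convOn_oddKernel hα hf hφ.continuous_deriv.aestronglyMeasurable
    fun x _ => hC x
  simp only [rieszFracDeriv_eq hα hφ]
  have e : ∀ x, f x * (1 / (2 * Real.Gamma (1 - α)) * convOn (oddKernel α) a b (deriv φ) x) =
      1 / (2 * Real.Gamma (1 - α)) * (f x * convOn (oddKernel α) a b (deriv φ) x) := fun x => by
    ring
  simp only [e]
  rw [integral_const_mul, ← neg_eq_iff_eq_neg.2 h]
  simp only [mul_comm (deriv φ _)]
  ring

/-- F may blow up at a and b; everything happens on a compact subinterval at whose ends φ vanishes.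
-/
theorem IsTestFunction.integral_mul_deriv (hφ : IsTestFunction a b φ) (hab : a < b) {F F' : ℝ → ℝ}
    (hF : ∀ x ∈ Ioo a b, HasDerivAt F (F' x) x) (hF' : ContinuousOn F' (Ioo a b)) :
    ∫ x in Ioo a b, F x * deriv φ x = -∫ x in Ioo a b, F' x * φ x := by
  obtain ⟨c, d, hac, hcd, hdb, hψ⟩ := hφ.exists_subinterval hab
  have hsub : uIcc c d ⊆ Ioo a b := by
    rw [uIcc_of_le hcd.le]; exact Icc_subset_Ioo hac hdb
  have e : ∀ g : ℝ → ℝ, (∀ x, x ∉ Ioo c d → g x = 0) → (∀ x, x ∉ Ioo a b → g x = 0) →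
      ∫ x in Ioo a b, g x = ∫ x in c..d, g x := by
    intro g h1 h2
    rw [setIntegral_eq_integral_of_forall_compl_eq_zero h2,
      intervalIntegral.integral_of_le hcd.le, integral_Ioc_eq_integral_Ioo,
      setIntegral_eq_integral_of_forall_compl_eq_zero h1]
  rw [e _ (fun x hx => by rw [hψ.deriv_eq_zero hx, mul_zero])
      (fun x hx => by rw [hφ.deriv_eq_zero hx, mul_zero]),
    e _ (fun x hx => by rw [hψ.eq_zero hx, mul_zero])
      (fun x hx => by rw [hφ.eq_zero hx, mul_zero]),
    intervalIntegral.integral_mul_deriv_eq_deriv_mul (fun x hx => hF x (hsub hx))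
      (fun x _ => hφ.hasDerivAt x) (hF'.mono hsub).intervalIntegrable
      (hφ.continuous_deriv.intervalIntegrable _ _),
    hψ.eq_zero (x := d) (by simp), hψ.eq_zero (x := c) (by simp)]
  ring

/-- A primitive of a test function with vanishing integral is a test function. -/
theorem IsTestFunction.exists_primitive {ψ : ℝ → ℝ} (hψ : IsTestFunction a b ψ) (hab : a < b)
    (h0 : ∫ x in Ioo a b, ψ x = 0) : ∃ φ, IsTestFunction a b φ ∧ deriv φ = ψ := by
  obtain ⟨c, d, hac, hcd, hdb, hψ'⟩ := hψ.exists_subinterval hab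
  have hz : ∀ x, x ∉ Ioo c d → ψ x = 0 := fun x hx => hψ'.eq_zero hx
  have hcont := hψ.smooth.continuous
  have hii : ∀ u v, IntervalIntegrable ψ volume u v := fun u v => hcont.intervalIntegrable u v
  have hd : ∀ x, HasDerivAt (fun x => ∫ t in a..x, ψ t) (ψ x) x := fun x =>
    intervalIntegral.integral_hasDerivAt_right (hii a x)
      (hcont.stronglyMeasurableAtFilter _ _) hcont.continuousAt
  have hderiv : deriv (fun x => ∫ t in a..x, ψ t) = ψ := funext fun x => (hd x).deriv
  have hsupp : ∀ x, x ∉ Icc c d → ∫ t in a..x, ψ t = 0 := by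
    intro x hx
    rw [mem_Icc, not_and_or, not_le, not_le] at hx
    rcases hx with hx | hx
    · rw [intervalIntegral.integral_congr (g := fun _ => 0), intervalIntegral.integral_zero]
      intro t ht
      refine hz t fun h => ?_
      have := ht.2
      rcases le_total a x with h' | h'
      · rw [sup_of_le_right h'] at this; linarith [h.1]
      · rw [sup_of_le_left h'] at this; linarith [h.1]
    · rw [← intervalIntegral.integral_add_adjacent_intervals (hii a b) (hii b x),
        intervalIntegral.integral_of_le hab.le, integral_Ioc_eq_integral_Ioo, h0, zero_add,
        intervalIntegral.integral_congr (g := fun _ => 0), intervalIntegral.integral_zero]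
      intro t ht
      refine hz t fun h => ?_
      have := ht.1
      rcases le_total b x with h' | h'
      · rw [inf_of_le_left h'] at this; linarith [h.2]
      · rw [inf_of_le_right h'] at this; linarith [h.2]
  have hts : tsupport (fun x => ∫ t in a..x, ψ t) ⊆ Icc c d :=
    closure_minimal (fun x hx => by_contra fun h => hx (hsupp x h)) isClosed_Icc
  refine ⟨fun x => ∫ t in a..x, ψ t, ⟨?_, ?_, ?_⟩, hderiv⟩
  · rw [contDiff_infty_iff_deriv]
    exact ⟨fun x => (hd x).differentiableAt, by rw [hderiv]; exact hψ.smooth⟩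
  · exact isCompact_Icc.of_isClosed_subset (isClosed_tsupport _) hts
  · exact hts.trans fun x hx => ⟨hac.trans_le hx.1, hx.2.trans_lt hdb⟩

theorem exists_isTestFunction_integral_eq_one (hab : a < b) :
    ∃ η, IsTestFunction a b η ∧ ∫ x in Ioo a b, η x = 1 := by
  -- The closed ball of radius (b - a)/4 about the midpoint lies inside (a, b).
  let f : ContDiffBump ((a + b) / 2) := ⟨(b - a) / 8, (b - a) / 4, by linarith, by linarith⟩
  have hsub : tsupport (f.normed volume) ⊆ Ioo a b := by
    rw [f.tsupport_normed_eq, Real.closedBall_eq_Icc]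
    intro x hx
    have h1 := hx.1
    have h2 := hx.2
    simp only [f] at h1 h2
    constructor <;> linarith
  have hη : IsTestFunction a b (f.normed volume) :=
    ⟨f.contDiff_normed, f.hasCompactSupport_normed, hsub⟩
  refine ⟨_, hη, ?_⟩
  rw [setIntegral_eq_integral_of_forall_compl_eq_zero fun x hx => hη.eq_zero hx]
  exact f.integral_normed

/-- The du Bois-Reymond lemma. -/
theorem ae_eq_const_of_integral_mul_deriv_eq_zero {F : ℝ → ℝ} (hab : a < b)
    (hF : IntegrableOn F (Ioo a b))
    (h : ∀ φ, IsTestFunction a b φ → ∫ x in Ioo a b, F x * deriv φ x = 0) :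
    ∃ C, F =ᵐ[volume.restrict (Ioo a b)] fun _ => C := by
  obtain ⟨η, hη, h1⟩ := exists_isTestFunction_integral_eq_one hab
  have hint : ∀ ψ, IsTestFunction a b ψ → IntegrableOn (fun x => F x * ψ x) (Ioo a b) := by
    intro ψ hψ
    obtain ⟨C, hC⟩ := hψ.exists_bound
    exact hF.mul_bdd (c := C) hψ.smooth.continuous.aestronglyMeasurable
      (ae_of_all _ fun x => hC x)
  have hint' : ∀ ψ, IsTestFunction a b ψ → IntegrableOn ψ (Ioo a b) := fun ψ hψ =>
    (hψ.smooth.continuous.integrable_of_hasCompactSupport hψ.compact).integrableOn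
  -- Since η has mass one, a constant F must equal its pairing with η.
  refine ⟨∫ x in Ioo a b, F x * η x, ?_⟩
  set C := ∫ x in Ioo a b, F x * η x with hC
  have key := isOpen_Ioo.ae_eq_zero_of_integral_contDiff_smul_eq_zero (μ := volume)
    (f := fun x => F x - C) (U := Ioo a b)
    ((hF.sub (integrableOn_const (by simp))).locallyIntegrableOn) ?_
  · rw [EventuallyEq, ae_restrict_iff' measurableSet_Ioo]
    filter_upwards [key] with x hx hm
    linarith [hx hm]
  intro ψ hs hc ht
  have hψ : IsTestFunction a b ψ := ⟨hs, hc, ht⟩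
  set m := ∫ x in Ioo a b, ψ x with hm
  -- Subtracting the multiple of η with the same mass leaves a function of mean zero, hence the
  -- derivative of a test function, to which `h` applies.
  have hdiff : IsTestFunction a b (fun x => ψ x - m * η x) := by
    refine ⟨hs.sub (contDiff_const.mul hη.smooth), hc.sub hη.compact.mul_left, ?_⟩
    exact (tsupport_sub _ _).trans (union_subset ht
      ((closure_mono (Function.support_mul_subset_right _ _)).trans hη.support_subset))
  obtain ⟨φ, hφ, hd⟩ := hdiff.exists_primitive hab (by
    rw [integral_sub (hint' ψ hψ) ((hint' η hη).const_mul m), integral_const_mul, h1]; ring)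
  have h2 := h φ hφ
  rw [hd] at h2
  have e : ∀ x, F x * (ψ x - m * η x) = F x * ψ x - m * (F x * η x) := fun x => by ring
  simp only [e] at h2
  rw [integral_sub (hint ψ hψ) ((hint η hη).const_mul m), integral_const_mul, ← hC] at h2
  rw [← setIntegral_eq_integral_of_forall_compl_eq_zero (s := Ioo a b)
    fun x hx => by simp [hψ.eq_zero hx]]
  have e2 : ∀ x, ψ x • (F x - C) = F x * ψ x - C * ψ x := fun x => by simp only [smul_eq_mul]; ring
  simp only [e2]
  rw [integral_sub (hint ψ hψ) ((hint' ψ hψ).const_mul C), integral_const_mul, ← hm]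
  linarith

end TestFunction

/-! ### The ladder: from the potential of f to that of y f -/

section Ladder

variable {a b α : ℝ} {f : ℝ → ℝ}

theorem hasDerivAt_abs_rpow {t : ℝ} (ht : t ≠ 0) :
    HasDerivAt (fun t : ℝ => |t| ^ (1 - α)) ((1 - α) * oddKernel α t) t := by
  rcases ht.lt_or_gt with h | h
  · have h1 : HasDerivAt (fun t : ℝ => (-t) ^ (1 - α)) ((1 - α) * oddKernel α t) t := by
      have := (hasDerivAt_neg t).rpow_const (p := 1 - α) (Or.inl (by linarith))
      convert this using 1
      rw [oddKernel_of_neg h, show 1 - α - 1 = -α by ring]; ring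
    refine h1.congr_of_eventuallyEq ?_
    filter_upwards [eventually_lt_nhds h] with s hs
    rw [abs_of_neg hs]
  · have h1 : HasDerivAt (fun t : ℝ => t ^ (1 - α)) ((1 - α) * oddKernel α t) t := by
      have := (hasDerivAt_id' t).rpow_const (p := 1 - α) (Or.inl h.ne')
      convert this using 1
      rw [oddKernel_of_pos h, show 1 - α - 1 = -α by ring]; simp
    refine h1.congr_of_eventuallyEq ?_
    filter_upwards [eventually_gt_nhds h] with s hs
    rw [abs_of_pos hs]

theorem intervalIntegrable_oddKernel (hα : α < 1) (u v : ℝ) :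
    IntervalIntegrable (oddKernel α) volume u v :=
  ((locallyIntegrable_oddKernel hα).integrableOn_isCompact
    isCompact_uIcc).intervalIntegrable

/-- The primitive is continuous and differentiable off 0, and the kernel is integrable; the
fundamental theorem tolerates the one bad point. -/
theorem integral_oddKernel (hα : α < 1) (u v : ℝ) :
    ∫ t in u..v, (1 - α) * oddKernel α t = |v| ^ (1 - α) - |u| ^ (1 - α) :=
  integral_eq_of_hasDerivAt_off_countable (fun t : ℝ => |t| ^ (1 - α)) _ (countable_singleton 0)
    (continuous_abs_rpow (by linarith)).continuousOn
    (fun _ ht => hasDerivAt_abs_rpow ht.2) ((intervalIntegrable_oddKernel hα u v).const_mul _)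

theorem integrableOn_continuous_kernel {k : ℝ → ℝ} (hk : Continuous k)
    (hf : IntegrableOn f (Ioo a b)) (x : ℝ) : IntegrableOn (fun y => k (x - y) * f y) (Ioo a b) := by
  obtain ⟨C, hC⟩ := (isCompact_Icc (a := a) (b := b)).exists_bound_of_continuousOn
    (f := fun y => k (x - y)) (by fun_prop)
  refine hf.bdd_mul (c := C) (by fun_prop) ?_
  filter_upwards [ae_restrict_mem measurableSet_Ioo] with y hy using hC y (Ioo_subset_Icc_self hy)

/-- The potential with kernel `|t| ^ (1 - α)` is a primitive of the one with the odd kernel. -/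
theorem convOn_abs_rpow (hα : α < 1) (hf : IntegrableOn f (Ioo a b)) {x : ℝ} (hx : x ∈ Icc a b) :
    convOn (fun t => |t| ^ (1 - α)) a b f x = convOn (fun t => |t| ^ (1 - α)) a b f a +
      (1 - α) * ∫ t in a..x, convOn (oddKernel α) a b f t := by
  have hc := continuous_abs_rpow (by linarith : 0 ≤ 1 - α)
  have h1 := integrable_kernel_prod (locallyIntegrable_oddKernel hα) hf
  have h2 : Integrable (fun p : ℝ × ℝ => oddKernel α (p.1 - p.2) * f p.2)
      ((volume.restrict (Ioc a x)).prod (volume.restrict (Ioo a b))) := by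
    have e : volume.restrict (Ioc a x) = volume.restrict (Ioo a x) :=
      Measure.restrict_congr_set Ioo_ae_eq_Ioc.symm
    rw [e]
    rw [Measure.prod_restrict] at h1 ⊢
    exact IntegrableOn.mono_set h1 (prod_mono (Ioo_subset_Ioo_right hx.2) le_rfl)
  rw [← sub_eq_iff_eq_add', convOn, convOn, ← integral_sub (integrableOn_continuous_kernel hc hf x)
    (integrableOn_continuous_kernel hc hf a), intervalIntegral.integral_of_le hx.1]
  simp only [convOn]
  rw [integral_integral_swap (f := fun t y => oddKernel α (t - y) * f y) h2, ← integral_const_mul]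
  refine integral_congr_ae (ae_of_all _ fun y => ?_)
  have h3 := integral_oddKernel hα (a - y) (x - y)
  rw [← intervalIntegral.integral_comp_sub_right (fun t => (1 - α) * oddKernel α t) y,
    intervalIntegral.integral_const_mul, intervalIntegral.integral_of_le hx.1] at h3
  simp only
  rw [← sub_mul, ← h3, integral_mul_const]
  ring

theorem integrableOn_continuous_mul {g : ℝ → ℝ} (hg : Continuous g)
    (hf : IntegrableOn f (Ioo a b)) : IntegrableOn (fun y => g y * f y) (Ioo a b) := by
  obtain ⟨C, hC⟩ := (isCompact_Icc (a := a) (b := b)).exists_bound_of_continuousOn hg.continuousOn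
  refine hf.bdd_mul (c := C) (by fun_prop) ?_
  filter_upwards [ae_restrict_mem measurableSet_Ioo] with y hy using hC y (Ioo_subset_Icc_self hy)

/-- Write y = x - (x - y) under the integral and absorb x - y into the kernel. -/
theorem convOn_oddKernel_id_mul (hα : α < 1) (hf : IntegrableOn f (Ioo a b)) :
    convOn (oddKernel α) a b (fun y => y * f y) =ᵐ[volume.restrict (Ioo a b)]
      fun x => x * convOn (oddKernel α) a b f x - convOn (fun t => |t| ^ (1 - α)) a b f x := by
  have hc := continuous_abs_rpow (by linarith : 0 ≤ 1 - α)
  filter_upwards [ae_integrableOn_kernel (locallyIntegrable_oddKernel hα) hf] with x h1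
  simp only [convOn]
  rw [← integral_const_mul, ← integral_sub (h1.const_mul x) (integrableOn_continuous_kernel hc hf x)]
  refine integral_congr_ae (ae_of_all _ fun y => ?_)
  simp only [← oddKernel_mul_self hα]
  ring

open Polynomial in
theorem exists_antiderivative (p : ℝ[X]) :
    ∃ P : ℝ[X], P.derivative = p ∧ ∀ n, p.natDegree ≤ n → P.natDegree ≤ n + 1 := by
  refine ⟨p.sum fun i c => monomial (i + 1) (c / (i + 1)), ?_, fun n hn => ?_⟩
  · conv_rhs => rw [← p.sum_monomial_eq]
    simp only [Polynomial.sum, derivative_sum, derivative_monomial]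
    refine Finset.sum_congr rfl fun i _ => ?_
    congr 1
    push_cast
    have : (i : ℝ) + 1 ≠ 0 := by positivity
    field_simp
  · refine natDegree_sum_le_of_forall_le _ _ fun i hi => (natDegree_monomial_le _).trans ?_
    have := le_natDegree_of_mem_supp i hi
    omega

theorem integral_eval (P : Polynomial ℝ) (u v : ℝ) :
    ∫ t in u..v, P.derivative.eval t = P.eval v - P.eval u :=
  intervalIntegral.integral_eq_sub_of_hasDerivAt (fun x _ => P.hasDerivAt x)
    (P.derivative.continuous.intervalIntegrable _ _)

-- If Tf = P', then the potential with kernel |t|^(1 - α) is (1 - α)P up to a constant, so T(y f) is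
-- again a polynomial. Iterating this yields all polynomial images below.
open Polynomial in
theorem convOn_oddKernel_id_mul_of_eval (hα : α < 1) (hf : IntegrableOn f (Ioo a b))
    {P : ℝ[X]}
    (h : convOn (oddKernel α) a b f =ᵐ[volume.restrict (Ioo a b)] fun x => P.derivative.eval x) :
    convOn (oddKernel α) a b (fun y => y * f y) =ᵐ[volume.restrict (Ioo a b)]
      fun x => (X * P.derivative - C (convOn (fun t => |t| ^ (1 - α)) a b f a -
        (1 - α) * P.eval a) - C (1 - α) * P).eval x := by
  filter_upwards [convOn_oddKernel_id_mul hα hf, h, ae_restrict_mem measurableSet_Ioo]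
    with x h1 h2 hx
  have h3 : ∫ t in a..x, convOn (oddKernel α) a b f t = P.eval x - P.eval a := by
    rw [← integral_eval, intervalIntegral.integral_of_le hx.1.le,
      intervalIntegral.integral_of_le hx.1.le, integral_Ioc_eq_integral_Ioo,
      integral_Ioc_eq_integral_Ioo]
    exact integral_congr_ae (ae_restrict_of_ae_restrict_of_subset (Ioo_subset_Ioo_right hx.2.le) h)
  rw [h1, h2, convOn_abs_rpow hα hf (Ioo_subset_Icc_self hx), h3]
  simp only [eval_sub, eval_mul, eval_X, eval_C]
  ring

end Ladder

/-! ### The null weight and the Möbius involution -/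

section NullWeight

variable {a b α : ℝ}

theorem integrableOn_rpow_mul_rpow (hab : a < b) {β γ : ℝ} (hβ : -1 < β) (hγ : -1 < γ) :
    IntegrableOn (fun x => (x - a) ^ β * (b - x) ^ γ) (Ioo a b) := by
  set m := (a + b) / 2 with hm
  have ham : a < m := by rw [hm]; linarith
  have hmb : m < b := by rw [hm]; linarith
  have h1 : IntegrableOn (fun x => (x - a) ^ β) (Icc a m) := by
    have h := (intervalIntegral.intervalIntegrable_rpow' (a := a - a) (b := m - a) hβ).comp_sub_right
      a
    rw [sub_add_cancel, sub_add_cancel] at h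
    exact (intervalIntegrable_iff_integrableOn_Icc_of_le ham.le).1 h
  have h2 : IntegrableOn (fun x => (b - x) ^ γ) (Icc m b) := by
    have h := (intervalIntegral.intervalIntegrable_rpow' (a := b - m) (b := b - b) hγ).comp_sub_left
      b
    rw [sub_sub_cancel, sub_sub_cancel] at h
    exact (intervalIntegrable_iff_integrableOn_Icc_of_le hmb.le).1 h
  have h3 : ContinuousOn (fun x : ℝ => (b - x) ^ γ) (Icc a m) :=
    ContinuousOn.rpow_const (by fun_prop) fun x hx => Or.inl (by linarith [hx.2])
  have h4 : ContinuousOn (fun x : ℝ => (x - a) ^ β) (Icc m b) :=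
    ContinuousOn.rpow_const (by fun_prop) fun x hx => Or.inl (by linarith [hx.1])
  have h5 := h1.mul_continuousOn h3 isCompact_Icc
  have h6 := h2.continuousOn_mul h4 isCompact_Icc
  refine (h5.union h6).mono_set ?_
  rw [Icc_union_Icc_eq_Icc ham.le hmb.le]
  exact Ioo_subset_Icc_self

/-- The even null function `((x - a) (b - x)) ^ (α / 2 - 1)` of the Riesz derivative. -/
def nullWeight (a b α x : ℝ) : ℝ := (x - a) ^ (α / 2 - 1) * (b - x) ^ (α / 2 - 1)

theorem integrableOn_nullWeight (hab : a < b) (hα : 0 < α) :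
    IntegrableOn (nullWeight a b α) (Ioo a b) :=
  integrableOn_rpow_mul_rpow hab (by linarith) (by linarith)

theorem nullWeight_pos {x : ℝ} (hx : x ∈ Ioo a b) : 0 < nullWeight a b α x :=
  mul_pos (Real.rpow_pos_of_pos (by linarith [hx.1]) _) (Real.rpow_pos_of_pos (by linarith [hx.2]) _)

/-- Jacobian times transformed integrand equals the original integrand. The exponents of p and q add
up to 2 - α + 2(α/2 - 1) = 0 and that of D to the negative of this; α/2 - 1 is the exponent for
which they cancel. -/
theorem moebius_weight_identity {p q u A B D α : ℝ} (hp : 0 < p) (hq : 0 < q) (hu : 0 < u)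
    (hA : 0 < A) (hB : 0 < B) (hD : 0 < D) :
    (p * q / D) ^ 2 * ((p * q * u / D) ^ (-α) * ((p ^ 2 * A / D) ^ (α / 2 - 1) *
      (q ^ 2 * B / D) ^ (α / 2 - 1))) = u ^ (-α) * (B ^ (α / 2 - 1) * A ^ (α / 2 - 1)) := by
  rw [← Real.rpow_natCast]
  -- With all positive quantities written as exponentials, the claim is a linear identity of
  -- exponents.
  obtain ⟨p, rfl⟩ : ∃ P, Real.exp P = p := ⟨_, Real.exp_log hp⟩
  obtain ⟨q, rfl⟩ : ∃ P, Real.exp P = q := ⟨_, Real.exp_log hq⟩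
  obtain ⟨u, rfl⟩ : ∃ P, Real.exp P = u := ⟨_, Real.exp_log hu⟩
  obtain ⟨A, rfl⟩ : ∃ P, Real.exp P = A := ⟨_, Real.exp_log hA⟩
  obtain ⟨B, rfl⟩ : ∃ P, Real.exp P = B := ⟨_, Real.exp_log hB⟩
  obtain ⟨D, rfl⟩ : ∃ P, Real.exp P = D := ⟨_, Real.exp_log hD⟩
  simp only [sq, ← Real.exp_add, ← Real.exp_sub, ← Real.exp_mul]
  congr 1
  push_cast
  ring

/-- Change of variables by the Möbius involution M that fixes x and exchanges a and b. It carries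
(a, x) onto (x, b), and its derivative is -(pq/D)². -/
theorem integral_left_eq_integral_right {x : ℝ} (hx : x ∈ Ioo a b) :
    ∫ y in Ioo x b, (y - x) ^ (-α) * nullWeight a b α y =
      ∫ y in Ioo a x, (x - y) ^ (-α) * nullWeight a b α y := by
  obtain ⟨hax, hxb⟩ := hx
  set p := x - a with hp
  set q := b - x with hq
  have hp0 : 0 < p := by linarith
  have hq0 : 0 < q := by linarith
  set D : ℝ → ℝ := fun y => p * q + (q - p) * (y - x) with hD
  have hDpos : ∀ y ∈ Ioo a b, 0 < D y := by
    intro y hy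
    have h1 : 0 < y - x + p := by linarith [hy.1]
    have h2 : 0 < q - (y - x) := by linarith [hy.2]
    -- D is affine with the values p² at a and q² at b, hence positive in between.
    have : D y = (p ^ 2 * (q - (y - x)) + q ^ 2 * (y - x + p)) / (p + q) := by
      rw [eq_div_iff (by positivity)]
      simp only [hD]; ring
    rw [this]
    positivity
  set M : ℝ → ℝ := fun y => x - p * q * (y - x) / D y with hM
  have hMa : ∀ y ∈ Ioo a b, M y - a = p ^ 2 * (b - y) / D y := by
    intro y hy
    have := (hDpos y hy).ne'
    rw [eq_div_iff this]
    simp only [hM]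
    field_simp
    simp only [hD, hp, hq]; ring
  have hMb : ∀ y ∈ Ioo a b, b - M y = q ^ 2 * (y - a) / D y := by
    intro y hy
    have := (hDpos y hy).ne'
    rw [eq_div_iff this]
    simp only [hM]
    field_simp
    simp only [hD, hp, hq]; ring
  have hMmem : ∀ y ∈ Ioo a b, M y ∈ Ioo a b := by
    intro y hy
    have h1 := hMa y hy
    have h2 := hMb y hy
    have h3 : 0 < p ^ 2 * (b - y) / D y :=
      div_pos (mul_pos (by positivity) (by linarith [hy.2])) (hDpos y hy)
    have h4 : 0 < q ^ 2 * (y - a) / D y :=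
      div_pos (mul_pos (by positivity) (by linarith [hy.1])) (hDpos y hy)
    constructor <;> linarith
  have hDM : ∀ y ∈ Ioo a b, D (M y) = p ^ 2 * q ^ 2 / D y := by
    intro y hy
    have := (hDpos y hy).ne'
    rw [eq_div_iff this]
    have e : D (M y) = p * q + (q - p) * (-(p * q * (y - x) / D y)) := by
      simp only [hM, hD]; ring
    rw [e]
    field_simp
    simp only [hD]; ring
  have hMM : ∀ y ∈ Ioo a b, M (M y) = y := by
    intro y hy
    have h1 := (hDpos y hy).ne'
    have e : M (M y) = x - p * q * (-(p * q * (y - x) / D y)) / D (M y) := by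
      simp only [hM]; ring
    rw [e, hDM y hy]
    field_simp
    ring
  have hMlt : ∀ y ∈ Ioo a b, (y < x ↔ x < M y) := by
    intro y hy
    have h : M y - x = p * q / D y * (x - y) := by simp only [hM]; ring
    have h' : 0 < p * q / D y := div_pos (by positivity) (hDpos y hy)
    rw [← sub_pos (a := M y), h, mul_pos_iff_of_pos_left h', sub_pos]
  have himg : M '' Ioo a x = Ioo x b := by
    apply Subset.antisymm
    · rintro _ ⟨y, hy, rfl⟩
      have hy' : y ∈ Ioo a b := ⟨hy.1, hy.2.trans hxb⟩
      exact ⟨(hMlt y hy').1 hy.2, (hMmem y hy').2⟩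
    · intro z hz
      have hz' : z ∈ Ioo a b := ⟨hax.trans hz.1, hz.2⟩
      refine ⟨M z, ⟨(hMmem z hz').1, ?_⟩, hMM z hz'⟩
      rw [hMlt _ (hMmem z hz'), hMM z hz']
      exact hz.1
  have hsub : Ioo a x ⊆ Ioo a b := Ioo_subset_Ioo_right hxb.le
  have hinj : InjOn M (Ioo a x) := fun y hy z hz h => by
    rw [← hMM y (hsub hy), ← hMM z (hsub hz), h]
  have hder : ∀ y ∈ Ioo a x, HasDerivWithinAt M (-(p * q / D y) ^ 2) (Ioo a x) y := by
    intro y hy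
    have h0 := (hDpos y (hsub hy)).ne'
    have hDd : HasDerivAt D (q - p) y := by
      have : HasDerivAt (fun y => p * q + (q - p) * (y - x)) (q - p) y := by
        simpa using (((hasDerivAt_id y).sub_const x).const_mul (q - p)).const_add (p * q)
      exact this
    have h1 : HasDerivAt (fun y => p * q * (y - x)) (p * q) y := by
      simpa using ((hasDerivAt_id y).sub_const x).const_mul (p * q)
    have h2 := (h1.div hDd h0).const_sub x
    refine (h2.congr_deriv ?_).hasDerivWithinAt
    field_simp
    simp only [hD]; ring
  rw [← himg, integral_image_eq_integral_abs_deriv_smul measurableSet_Ioo hder hinj]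
  refine setIntegral_congr_fun measurableSet_Ioo fun y hy => ?_
  have hy' := hsub hy
  have e : M y - x = p * q * (x - y) / D y := by simp only [hM]; ring
  simp only [nullWeight, smul_eq_mul]
  rw [abs_neg, abs_of_nonneg (sq_nonneg _), e, hMa y hy', hMb y hy',
    moebius_weight_identity hp0 hq0 (by linarith [hy.2]) (by linarith [hy'.2]) (by linarith [hy.1])
      (hDpos y hy')]

/-- The odd kernel gives opposite signs to the two sides of x, whose contributions agree in size by
the Möbius symmetry. -/
theorem convOn_oddKernel_nullWeight (hab : a < b) (hα0 : 0 < α) (hα : α < 1) :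
    convOn (oddKernel α) a b (nullWeight a b α) =ᵐ[volume.restrict (Ioo a b)] fun _ => 0 := by
  filter_upwards [ae_integrableOn_kernel (locallyIntegrable_oddKernel hα)
    (integrableOn_nullWeight hab hα0), ae_restrict_mem measurableSet_Ioo] with x hi hx
  have h1 : IntervalIntegrable (fun y => oddKernel α (x - y) * nullWeight a b α y) volume a x :=
    (intervalIntegrable_iff_integrableOn_Ioo_of_le hx.1.le).2
      (hi.mono_set (Ioo_subset_Ioo_right hx.2.le))
  have h2 : IntervalIntegrable (fun y => oddKernel α (x - y) * nullWeight a b α y) volume x b :=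
    (intervalIntegrable_iff_integrableOn_Ioo_of_le hx.2.le).2
      (hi.mono_set (Ioo_subset_Ioo_left hx.1.le))
  have h3 := intervalIntegral.integral_add_adjacent_intervals h1 h2
  rw [intervalIntegral.integral_of_le hx.1.le, intervalIntegral.integral_of_le hx.2.le,
    intervalIntegral.integral_of_le hab.le, integral_Ioc_eq_integral_Ioo,
    integral_Ioc_eq_integral_Ioo, integral_Ioc_eq_integral_Ioo] at h3
  rw [convOn, ← h3]
  have e1 : ∫ y in Ioo a x, oddKernel α (x - y) * nullWeight a b α y =
      ∫ y in Ioo a x, (x - y) ^ (-α) * nullWeight a b α y :=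
    setIntegral_congr_fun measurableSet_Ioo fun y hy => by
      rw [oddKernel_of_pos (by linarith [hy.2])]
  have e2 : ∫ y in Ioo x b, oddKernel α (x - y) * nullWeight a b α y =
      -∫ y in Ioo x b, (y - x) ^ (-α) * nullWeight a b α y := by
    rw [← integral_neg]
    refine setIntegral_congr_fun measurableSet_Ioo fun y hy => ?_
    rw [oddKernel_of_neg (by linarith [hy.1]), neg_sub]; ring
  rw [e1, e2, integral_left_eq_integral_right hx, add_neg_cancel]

end NullWeight

/-! ### Null functions have constant odd potential -/

section RieszNull

variable {a b α : ℝ}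

theorem rieszNull_eq (c₁ c₂ : ℝ) {x : ℝ} (hx : x ∈ Ioo a b) :
    rieszNull a b α c₁ c₂ x = (c₁ * (x - a) + c₂ * (b - x)) * nullWeight a b α x := by
  have h1 : (x - a) ^ (α / 2) = (x - a) ^ (α / 2 - 1) * (x - a) := by
    rw [← Real.rpow_add_one (by linarith [hx.1]), sub_add_cancel]
  have h2 : (b - x) ^ (α / 2) = (b - x) ^ (α / 2 - 1) * (b - x) := by
    rw [← Real.rpow_add_one (by linarith [hx.2]), sub_add_cancel]
  rw [rieszNull, nullWeight, h1, h2]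
  ring

theorem integrableOn_rieszNull (hab : a < b) (hα : 0 < α) (c₁ c₂ : ℝ) :
    IntegrableOn (rieszNull a b α c₁ c₂) (Ioo a b) :=
  ((integrableOn_rpow_mul_rpow hab (by linarith) (by linarith)).const_mul c₁).add
    ((integrableOn_rpow_mul_rpow hab (by linarith) (by linarith)).const_mul c₂)

/-- The ladder starting from Tw = 0, with zero antiderivative: only the integration constant is
left. -/
theorem convOn_oddKernel_id_mul_nullWeight (hab : a < b) (hα0 : 0 < α) (hα : α < 1) :
    convOn (oddKernel α) a b (fun y => y * nullWeight a b α y) =ᵐ[volume.restrict (Ioo a b)]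
      fun _ => -convOn (fun t => |t| ^ (1 - α)) a b (nullWeight a b α) a := by
  have h := convOn_oddKernel_id_mul_of_eval hα (integrableOn_nullWeight hab hα0) (P := 0)
    (by simpa using convOn_oddKernel_nullWeight hab hα0 hα)
  simpa using h

/-- A null function is an affine combination of w and yw, whose potentials are zero and constant. -/
theorem convOn_oddKernel_rieszNull (hab : a < b) (hα0 : 0 < α) (hα : α < 1) (c₁ c₂ : ℝ) :
    ∃ C, convOn (oddKernel α) a b (rieszNull a b α c₁ c₂) =ᵐ[volume.restrict (Ioo a b)]
      fun _ => C := by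
  have hw := integrableOn_nullWeight hab hα0
  have hyw := integrableOn_continuous_mul continuous_id hw
  have e : rieszNull a b α c₁ c₂ =ᵐ[volume.restrict (Ioo a b)] fun y =>
      (c₁ - c₂) * (y * nullWeight a b α y) + (c₂ * b - c₁ * a) * nullWeight a b α y := by
    filter_upwards [ae_restrict_mem measurableSet_Ioo] with y hy
    rw [rieszNull_eq c₁ c₂ hy]; ring
  refine ⟨(c₁ - c₂) * -convOn (fun t => |t| ^ (1 - α)) a b (nullWeight a b α) a, ?_⟩
  rw [convOn_congr_ae e]
  filter_upwards [convOn_add_ae (locallyIntegrable_oddKernel hα) (hyw.const_mul (c₁ - c₂))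
    (hw.const_mul (c₂ * b - c₁ * a)), convOn_oddKernel_nullWeight hab hα0 hα,
    convOn_oddKernel_id_mul_nullWeight hab hα0 hα] with x h1 h2 h3
  simp only [id] at h1
  rw [h1, convOn_const_mul, convOn_const_mul, h2, h3]
  ring

theorem integral_rieszNull_mul_rieszFracDeriv (hab : a < b) (hα0 : 0 < α) (hα : α < 1)
    (c₁ c₂ : ℝ) {φ : ℝ → ℝ} (hφ : IsTestFunction a b φ) :
    ∫ x in Ioo a b, rieszNull a b α c₁ c₂ x * rieszFracDeriv α φ x = 0 := by
  rw [integral_mul_rieszFracDeriv hα hφ (integrableOn_rieszNull hab hα0 c₁ c₂)]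
  obtain ⟨C, hC⟩ := convOn_oddKernel_rieszNull hab hα0 hα c₁ c₂
  have e : ∫ x in Ioo a b, convOn (oddKernel α) a b (rieszNull a b α c₁ c₂) x * deriv φ x =
      ∫ x in Ioo a b, C * deriv φ x := by
    refine integral_congr_ae ?_
    filter_upwards [hC] with x hx
    rw [hx]
  rw [e, integral_const_mul, hφ.integral_deriv, mul_zero, mul_zero]

end RieszNull

/-! ### Existence of the one-sided weak derivatives, and part (i) -/

section LeftDerivative

variable {a b α β γ L : ℝ}

/-- The integral `∫₀¹ (1 - t) ^ (-α) t ^ β (L - s t) ^ γ dt`. -/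
def eulerIntegral (α β γ L s : ℝ) : ℝ :=
  ∫ t in Ioo (0 : ℝ) 1, (1 - t) ^ (-α) * t ^ β * (L - s * t) ^ γ

theorem integrableOn_eulerIntegrand (hα : α < 1) (hβ : -1 < β) {s : ℝ} (hs : s ∈ Ioo 0 L) :
    IntegrableOn (fun t => (1 - t) ^ (-α) * t ^ β * (L - s * t) ^ γ) (Ioo (0 : ℝ) 1) := by
  have h0 : IntegrableOn (fun t : ℝ => (1 - t) ^ (-α) * t ^ β) (Ioo (0 : ℝ) 1) := by
    refine (integrableOn_rpow_mul_rpow zero_lt_one hβ (by linarith : -1 < -α)).congr_fun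
      (fun t _ => ?_) measurableSet_Ioo
    simp only [sub_zero]; ring
  have hc : ContinuousOn (fun t : ℝ => (L - s * t) ^ γ) (Icc 0 1) :=
    ContinuousOn.rpow_const (by fun_prop) fun t ht => Or.inl (by nlinarith [ht.1, ht.2, hs.1, hs.2])
  obtain ⟨C, hC⟩ := isCompact_Icc.exists_bound_of_continuousOn hc
  refine Integrable.mul_bdd (c := C) h0 ((hc.mono Ioo_subset_Icc_self).aestronglyMeasurable
    measurableSet_Ioo) ?_
  filter_upwards [ae_restrict_mem measurableSet_Ioo] with y hy using hC y (Ioo_subset_Icc_self hy)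

/-- Differentiation under the integral stays in the family: β rises by one and γ drops by one. -/
theorem hasDerivAt_eulerIntegral (hα : α < 1) (hβ : -1 < β) {s : ℝ} (hs : s ∈ Ioo 0 L) :
    HasDerivAt (eulerIntegral α β γ L) (-γ * eulerIntegral α (β + 1) (γ - 1) L s) s := by
  -- For parameters below s₁ the base L - xt stays above L - s₁ > 0, which gives a dominating
  -- function for every exponent γ - 1.
  obtain ⟨s₁, hs₁, hs₁L⟩ := exists_between hs.2
  have hs0 := hs.1
  have hpos : ∀ x ∈ Ioo 0 s₁, ∀ t ∈ Ioo (0 : ℝ) 1, L - x * t ∈ Icc (L - s₁) L := by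
    intro x hx t ht
    have h1 : 0 < x * t := mul_pos hx.1 ht.1
    have h2 : x * t < x := by nlinarith [hx.1, ht.2]
    exact ⟨by linarith [hx.2], by linarith⟩
  have hc : ContinuousOn (fun v : ℝ => v ^ (γ - 1)) (Icc (L - s₁) L) :=
    ContinuousOn.rpow_const (by fun_prop) fun v hv => Or.inl (by linarith [hv.1])
  obtain ⟨C, hC⟩ := isCompact_Icc.exists_bound_of_continuousOn hc
  have h0 : IntegrableOn (fun t : ℝ => (1 - t) ^ (-α) * t ^ (β + 1)) (Ioo (0 : ℝ) 1) := by
    refine (integrableOn_rpow_mul_rpow zero_lt_one (by linarith : -1 < β + 1)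
      (by linarith : -1 < -α)).congr_fun (fun t _ => ?_) measurableSet_Ioo
    simp only [sub_zero]; ring
  have hnhds : Ioo 0 s₁ ∈ 𝓝 s := Ioo_mem_nhds hs.1 hs₁
  have key := hasDerivAt_integral_of_dominated_loc_of_deriv_le (μ := volume.restrict (Ioo (0 : ℝ) 1))
    (F := fun x t => (1 - t) ^ (-α) * t ^ β * (L - x * t) ^ γ)
    (F' := fun x t => -γ * ((1 - t) ^ (-α) * t ^ (β + 1) * (L - x * t) ^ (γ - 1)))
    (bound := fun t => |γ| * ((1 - t) ^ (-α) * t ^ (β + 1) * C)) hnhds ?_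
    (integrableOn_eulerIntegrand hα hβ hs) ?_ ?_ ?_ ?_
  · have h := key.2
    rw [integral_const_mul] at h
    exact h
  · filter_upwards [hnhds] with x hx
    exact (integrableOn_eulerIntegrand hα hβ ⟨hx.1, hx.2.trans hs₁L⟩).aestronglyMeasurable
  · exact ((integrableOn_eulerIntegrand hα (by linarith) hs).const_mul _).aestronglyMeasurable
  · filter_upwards [ae_restrict_mem measurableSet_Ioo] with t ht x hx
    have h1 := hC _ (hpos x hx t ht)
    have h2 : 0 ≤ (1 - t) ^ (-α) * t ^ (β + 1) :=
      mul_nonneg (Real.rpow_nonneg (by linarith [ht.2]) _) (Real.rpow_nonneg ht.1.le _)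
    rw [norm_mul, norm_neg, norm_mul, Real.norm_eq_abs, Real.norm_of_nonneg h2]
    gcongr
  · exact (h0.mul_const C).const_mul _
  · filter_upwards [ae_restrict_mem measurableSet_Ioo] with t ht x hx
    have h1 : L - x * t ≠ 0 := by linarith [(hpos x hx t ht).1]
    have h2 : HasDerivAt (fun x => L - x * t) (-t) x := by
      simpa using ((hasDerivAt_id x).mul_const t).const_sub L
    have h3 := (h2.rpow_const (p := γ) (Or.inl h1)).const_mul ((1 - t) ^ (-α) * t ^ β)
    refine h3.congr_deriv ?_
    rw [Real.rpow_add_one ht.1.ne']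
    ring

/-- The scaling y = a + (x - a)t fixes the singularity of the kernel at t = 1, so that x enters only
through factors smooth on the open interval. -/
theorem convOn_leftKernel_rpow_mul_rpow {x : ℝ} (hx : x ∈ Ioo a b) :
    convOn (leftKernel α) a b (fun y => (y - a) ^ β * (b - y) ^ γ) x =
      (x - a) ^ (1 - α + β) * eulerIntegral α β γ (b - a) (x - a) := by
  have hs : 0 < x - a := by linarith [hx.1]
  have e1 : convOn (leftKernel α) a b (fun y => (y - a) ^ β * (b - y) ^ γ) x =
      ∫ y in a..x, (x - y) ^ (-α) * ((y - a) ^ β * (b - y) ^ γ) := by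
    rw [intervalIntegral.integral_of_le hx.1.le, integral_Ioc_eq_integral_Ioo, convOn,
      ← integral_indicator measurableSet_Ioo, ← integral_indicator measurableSet_Ioo]
    congr 1
    funext y
    by_cases hy : y ∈ Ioo a x
    · rw [indicator_of_mem hy, indicator_of_mem (show y ∈ Ioo a b from ⟨hy.1, hy.2.trans hx.2⟩),
        leftKernel_of_pos (by linarith [hy.2])]
    · rw [indicator_of_notMem hy]
      by_cases hy' : y ∈ Ioo a b
      · rw [indicator_of_mem hy', leftKernel_of_nonpos, zero_mul]
        by_contra h
        exact hy ⟨hy'.1, by linarith⟩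
      · rw [indicator_of_notMem hy']
  have e2 := intervalIntegral.smul_integral_comp_add_mul (a := 0) (b := 1)
    (fun y => (x - y) ^ (-α) * ((y - a) ^ β * (b - y) ^ γ)) (x - a) a
  rw [mul_zero, add_zero, mul_one, add_sub_cancel] at e2
  rw [e1, ← e2, intervalIntegral.integral_of_le zero_le_one, integral_Ioc_eq_integral_Ioo,
    smul_eq_mul, eulerIntegral, ← integral_const_mul, ← integral_const_mul]
  refine setIntegral_congr_fun measurableSet_Ioo fun t ht => ?_
  have h1 : x - (a + (x - a) * t) = (x - a) * (1 - t) := by ring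
  have h2 : a + (x - a) * t - a = (x - a) * t := by ring
  have h3 : b - (a + (x - a) * t) = b - a - (x - a) * t := by ring
  simp only [h1, h2, h3]
  rw [Real.mul_rpow hs.le (by linarith [ht.2]), Real.mul_rpow hs.le ht.1.le,
    show 1 - α + β = 1 + -α + β by ring, Real.rpow_add hs, Real.rpow_add hs, Real.rpow_one]
  ring

theorem exists_hasDerivAt_convOn_leftKernel (hα : α < 1) (hβ : -1 < β) :
    ∃ F' : ℝ → ℝ, ContinuousOn F' (Ioo a b) ∧ ∀ x ∈ Ioo a b,
      HasDerivAt (convOn (leftKernel α) a b (fun y => (y - a) ^ β * (b - y) ^ γ)) (F' x) x := by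
  have hsub : ∀ x ∈ Ioo a b, x - a ∈ Ioo 0 (b - a) := fun x hx =>
    ⟨by linarith [hx.1], by linarith [hx.2]⟩
  have hE : ∀ β' γ' : ℝ, -1 < β' → ∀ x ∈ Ioo a b, HasDerivAt
      (fun x => eulerIntegral α β' γ' (b - a) (x - a))
      (-γ' * eulerIntegral α (β' + 1) (γ' - 1) (b - a) (x - a)) x := by
    intro β' γ' h x hx
    exact (hasDerivAt_eulerIntegral (γ := γ') hα h (hsub x hx)).comp_sub_const x a
  have hP : ∀ x ∈ Ioo a b, HasDerivAt (fun x => (x - a) ^ (1 - α + β))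
      ((1 - α + β) * (x - a) ^ (1 - α + β - 1)) x := by
    intro x hx
    have := ((hasDerivAt_id x).sub_const a).rpow_const (p := 1 - α + β)
      (Or.inl (hsub x hx).1.ne')
    simpa using this
  refine ⟨fun x => (1 - α + β) * (x - a) ^ (1 - α + β - 1) * eulerIntegral α β γ (b - a) (x - a) +
    (x - a) ^ (1 - α + β) * (-γ * eulerIntegral α (β + 1) (γ - 1) (b - a) (x - a)), ?_, ?_⟩
  · have c1 : ContinuousOn (fun x => eulerIntegral α β γ (b - a) (x - a)) (Ioo a b) := fun x hx =>
      (hE β γ hβ x hx).continuousAt.continuousWithinAt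
    have c2 : ContinuousOn (fun x => eulerIntegral α (β + 1) (γ - 1) (b - a) (x - a)) (Ioo a b) :=
      fun x hx => (hE (β + 1) (γ - 1) (by linarith) x hx).continuousAt.continuousWithinAt
    have c3 : ∀ δ : ℝ, ContinuousOn (fun x => (x - a) ^ δ) (Ioo a b) := fun δ =>
      ContinuousOn.rpow_const (by fun_prop) fun x hx => Or.inl (hsub x hx).1.ne'
    exact ((continuousOn_const.mul (c3 _)).mul c1).add ((c3 _).mul (continuousOn_const.mul c2))
  · intro x hx
    refine ((hP x hx).mul (hE β γ hβ x hx)).congr_of_eventuallyEq ?_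
    filter_upwards [isOpen_Ioo.mem_nhds hx] with y hy
    exact convOn_leftKernel_rpow_mul_rpow hy

/-- Transposing the kernel turns the pairing of u with the right derivative of φ into a pairing of
the left potential of u with φ'; one integration by parts then finishes. Behaviour at the endpoints
is irrelevant, since a weak derivative need only be locally integrable. -/
theorem isLeftWeakFracDeriv_of_hasDerivAt {u F F' : ℝ → ℝ} (hab : a < b) (hα : α < 1)
    (hu : IntegrableOn u (Ioo a b))
    (hF : convOn (leftKernel α) a b u =ᵐ[volume.restrict (Ioo a b)] F)
    (hF' : ContinuousOn F' (Ioo a b)) (hd : ∀ x ∈ Ioo a b, HasDerivAt F (F' x) x) :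
    IsLeftWeakFracDeriv a b α u fun x => 1 / Real.Gamma (1 - α) * F' x := by
  refine ⟨hu, (continuousOn_const.mul hF').locallyIntegrableOn measurableSet_Ioo,
    fun φ hφ => ?_⟩
  obtain ⟨C, hC⟩ := hφ.exists_bound_deriv
  have h1 := integral_mul_convOn (locallyIntegrable_leftKernel hα) hu
    hφ.continuous_deriv.aestronglyMeasurable fun x _ => hC x
  have h2 := hφ.integral_mul_deriv hab hd hF'
  have h3 : ∫ x in Ioo a b, deriv φ x * convOn (leftKernel α) a b u x =
      ∫ x in Ioo a b, F x * deriv φ x := by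
    refine integral_congr_ae ?_
    filter_upwards [hF] with x hx
    rw [hx, mul_comm]
  rw [h1] at h3
  simp only [rightFracDeriv_eq hα hφ]
  have e1 : ∀ x, 1 / Real.Gamma (1 - α) * F' x * φ x =
    1 / Real.Gamma (1 - α) * (F' x * φ x) := fun x => by ring
  have e2 : ∀ x, u x * -(1 / Real.Gamma (1 - α) *
      convOn (fun t => leftKernel α (-t)) a b (deriv φ) x) =
    -(1 / Real.Gamma (1 - α)) * (u x * convOn (fun t => leftKernel α (-t)) a b (deriv φ) x) :=
    fun x => by ring
  simp only [e1, e2]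
  rw [integral_const_mul, integral_const_mul, h3, h2]
  ring

theorem exists_isLeftWeakFracDeriv_rieszNull (hab : a < b) (hα0 : 0 < α) (hα : α < 1)
    (c₁ c₂ : ℝ) : ∃ v, IsLeftWeakFracDeriv a b α (rieszNull a b α c₁ c₂) v := by
  obtain ⟨F₁, hF₁, hd₁⟩ := exists_hasDerivAt_convOn_leftKernel (a := a) (b := b) (γ := α / 2 - 1)
    hα (by linarith : -1 < α / 2)
  obtain ⟨F₂, hF₂, hd₂⟩ := exists_hasDerivAt_convOn_leftKernel (a := a) (b := b) (γ := α / 2)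
    hα (by linarith : -1 < α / 2 - 1)
  refine ⟨_, isLeftWeakFracDeriv_of_hasDerivAt hab hα (integrableOn_rieszNull hab hα0 c₁ c₂) ?_
    ((continuousOn_const.mul hF₁).add (continuousOn_const.mul hF₂)) fun x hx =>
      ((hd₁ x hx).const_mul c₁).add ((hd₂ x hx).const_mul c₂)⟩
  have h1 := (integrableOn_rpow_mul_rpow hab (by linarith : -1 < α / 2)
    (by linarith : -1 < α / 2 - 1)).const_mul c₁
  have h2 := (integrableOn_rpow_mul_rpow hab (by linarith : -1 < α / 2 - 1)
    (by linarith : -1 < α / 2)).const_mul c₂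
  filter_upwards [convOn_add_ae (locallyIntegrable_leftKernel hα) h1 h2] with x hx
  rw [convOn_const_mul, convOn_const_mul] at hx
  exact hx

theorem integrableOn_mul_kernel_deriv {u k φ : ℝ → ℝ} (hk : LocallyIntegrable k)
    (hφ : IsTestFunction a b φ) (hu : IntegrableOn u (Ioo a b)) :
    IntegrableOn (fun x => u x * convOn k a b (deriv φ) x) (Ioo a b) := by
  obtain ⟨C, hC⟩ := hφ.exists_bound_deriv
  obtain ⟨M, hM⟩ := bounded_convOn (a := a) (b := b) hk fun x _ => hC x
  refine Integrable.mul_bdd (c := M) hu (continuous_convOn_deriv hk hφ).aestronglyMeasurable ?_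
  filter_upwards [ae_restrict_mem measurableSet_Ioo] with x hx using hM x hx

theorem integral_mul_rieszFracDeriv_eq_add {u φ : ℝ → ℝ} (hα : α < 1)
    (hφ : IsTestFunction a b φ) (hu : IntegrableOn u (Ioo a b)) :
    ∫ x in Ioo a b, u x * rieszFracDeriv α φ x = 1 / 2 *
      ((∫ x in Ioo a b, u x * leftFracDeriv α φ x) +
        ∫ x in Ioo a b, u x * rightFracDeriv α φ x) := by
  have h1 : IntegrableOn (fun x => u x * leftFracDeriv α φ x) (Ioo a b) := by
    refine IntegrableOn.congr_fun ((integrableOn_mul_kernel_deriv (locallyIntegrable_leftKernel hα)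
      hφ hu).const_mul (1 / Real.Gamma (1 - α))) (fun x _ => ?_) measurableSet_Ioo
    rw [leftFracDeriv_eq hα hφ]; ring
  have h2 : IntegrableOn (fun x => u x * rightFracDeriv α φ x) (Ioo a b) := by
    refine IntegrableOn.congr_fun ((integrableOn_mul_kernel_deriv
      (locallyIntegrable_leftKernel_neg hα) hφ hu).const_mul (-(1 / Real.Gamma (1 - α))))
      (fun x _ => ?_) measurableSet_Ioo
    rw [rightFracDeriv_eq hα hφ]; ring
  rw [← integral_add h1 h2, ← integral_const_mul]
  congr 1; funext x
  rw [rieszFracDeriv]; ring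

theorem isRieszHarmonic_rieszNull (hab : a < b) (hα0 : 0 < α) (hα : α < 1) (c₁ c₂ : ℝ) :
    IsRieszHarmonic a b α (rieszNull a b α c₁ c₂) := by
  have hi := integrableOn_rieszNull hab hα0 c₁ c₂
  obtain ⟨v, hv⟩ := exists_isLeftWeakFracDeriv_rieszNull hab hα0 hα c₁ c₂
  -- The Riesz derivative is zero, so the right derivative must be minus the left one; no separate
  -- computation is needed for it.
  refine ⟨hi, fun _ => 0, integrableOn_zero, ⟨v, fun x => -v x, hv,
    ⟨hi, hv.locallyIntegrable.neg, fun φ hφ => ?_⟩, ae_of_all _ fun x => by ring⟩,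
    fun φ _ => by simp⟩
  have h1 := integral_mul_rieszFracDeriv_eq_add hα hφ hi
  rw [integral_rieszNull_mul_rieszFracDeriv hab hα0 hα c₁ c₂ hφ, ← hv.integral_eq φ hφ] at h1
  simp only [neg_mul, integral_neg]
  linarith

end LeftDerivative

/-! ### The Jacobi weight -/

section JacobiWeight

variable {α : ℝ}

theorem continuous_jacobiWeight (hα0 : 0 < α) : Continuous (jacobiWeight α) :=
  (continuous_id.rpow_const fun _ => Or.inr (by positivity)).mul
    ((continuous_const.sub continuous_id).rpow_const fun _ => Or.inr (by positivity))

theorem jacobiWeight_pos {x : ℝ} (hx : x ∈ Ioo (0 : ℝ) 1) : 0 < jacobiWeight α x :=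
  mul_pos (Real.rpow_pos_of_pos hx.1 _) (Real.rpow_pos_of_pos (by linarith [hx.2]) _)

theorem jacobiWeight_zero (hα0 : 0 < α) : jacobiWeight α 0 = 0 := by
  simp [jacobiWeight, Real.zero_rpow (by positivity : α / 2 ≠ 0)]

theorem jacobiWeight_one (hα0 : 0 < α) : jacobiWeight α 1 = 0 := by
  simp [jacobiWeight, Real.zero_rpow (by positivity : α / 2 ≠ 0)]

theorem jacobiWeight_eq {x : ℝ} (hx : x ∈ Ioo (0 : ℝ) 1) :
    jacobiWeight α x = x * (1 - x) * nullWeight 0 1 α x := by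
  have h1 : x ^ (α / 2) = x ^ (α / 2 - 1) * x := by
    rw [← Real.rpow_add_one hx.1.ne', sub_add_cancel]
  have h2 : (1 - x) ^ (α / 2) = (1 - x) ^ (α / 2 - 1) * (1 - x) := by
    rw [← Real.rpow_add_one (by linarith [hx.2]), sub_add_cancel]
  rw [jacobiWeight, nullWeight, h1, h2, sub_zero]
  ring

theorem hasDerivAt_jacobiWeight {x : ℝ} (hx : x ∈ Ioo (0 : ℝ) 1) :
    HasDerivAt (jacobiWeight α) (α / 2 * (1 - 2 * x) * nullWeight 0 1 α x) x := by
  have h0 : 1 - x ≠ 0 := by linarith [hx.2]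
  have h1 := (hasDerivAt_id' x).rpow_const (p := α / 2) (Or.inl hx.1.ne')
  have h2 := ((hasDerivAt_id' x).const_sub 1).rpow_const (p := α / 2) (Or.inl h0)
  refine (h1.mul h2).congr_deriv ?_
  have h3 : x ^ (α / 2) = x ^ (α / 2 - 1) * x := by
    rw [← Real.rpow_add_one hx.1.ne', sub_add_cancel]
  have h4 : (1 - x) ^ (α / 2) = (1 - x) ^ (α / 2 - 1) * (1 - x) := by
    rw [← Real.rpow_add_one h0, sub_add_cancel]
  rw [nullWeight, h3, h4, sub_zero]
  ring

theorem integrableOn_jacobiWeight_mul (hα0 : 0 < α) {g : ℝ → ℝ} (hg : Continuous g) :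
    IntegrableOn (fun x => jacobiWeight α x * g x) (Ioo 0 1) :=
  (((continuous_jacobiWeight hα0).mul hg).continuousOn.integrableOn_compact isCompact_Icc).mono_set
    Ioo_subset_Icc_self

theorem integrableOn_jacobiWeight_mul_mul (hα0 : 0 < α) {g h : ℝ → ℝ} (hg : Continuous g)
    (hh : Continuous h) : IntegrableOn (fun x => jacobiWeight α x * g x * h x) (Ioo 0 1) := by
  have := integrableOn_jacobiWeight_mul hα0 (hg.mul hh)
  simpa only [Pi.mul_apply, mul_assoc] using this

open Polynomial in
theorem eq_zero_of_integral_jacobiWeight_mul_sq_eq_zero (hα0 : 0 < α) {p : ℝ[X]}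
    (h : ∫ x in Ioo (0 : ℝ) 1, jacobiWeight α x * p.eval x ^ 2 = 0) : p = 0 := by
  have hi : IntegrableOn (fun x => jacobiWeight α x * p.eval x ^ 2) (Ioo 0 1) :=
    integrableOn_jacobiWeight_mul hα0 (p.continuous.pow 2)
  have h1 := (setIntegral_eq_zero_iff_of_nonneg_ae (by
    filter_upwards [ae_restrict_mem measurableSet_Ioo] with x hx
    exact mul_nonneg (jacobiWeight_pos hx).le (sq_nonneg _)) hi).1 h
  have h2 : (fun x => p.eval x) =ᵐ[volume.restrict (Ioo (0 : ℝ) 1)] fun _ => 0 := by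
    filter_upwards [h1, ae_restrict_mem measurableSet_Ioo] with x hx hm
    have := (mul_eq_zero.1 hx).resolve_left (jacobiWeight_pos hm).ne'
    exact pow_eq_zero_iff two_ne_zero |>.1 this
  have h3 : EqOn (fun x => p.eval x) (fun _ => 0) (Ioo 0 1) :=
    Measure.eqOn_Ioo_of_ae_eq volume h2 p.continuous.continuousOn continuousOn_const
  exact eq_zero_of_infinite_isRoot p ((Ioo_infinite zero_lt_one).mono fun x hx => h3 hx)

open Polynomial in
theorem integral_jacobiWeight_mul_sq_pos (hα0 : 0 < α) {p : ℝ[X]} (hp : p ≠ 0) :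
    0 < ∫ x in Ioo (0 : ℝ) 1, jacobiWeight α x * p.eval x ^ 2 := by
  refine lt_of_le_of_ne ?_ fun h =>
    hp (eq_zero_of_integral_jacobiWeight_mul_sq_eq_zero hα0 h.symm)
  exact setIntegral_nonneg measurableSet_Ioo fun x hx =>
    mul_nonneg (jacobiWeight_pos hx).le (sq_nonneg _)

end JacobiWeight

/-! ### Odd potentials of weighted polynomials -/

section PolynomialImages

open Polynomial

variable {α : ℝ}

theorem convOn_abs_rpow_nullWeight_pos (hα0 : 0 < α) (hα : α < 1) :
    0 < convOn (fun t => |t| ^ (1 - α)) 0 1 (nullWeight 0 1 α) 0 := by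
  have hpos : ∀ y ∈ Ioo (0 : ℝ) 1, 0 < |0 - y| ^ (1 - α) * nullWeight 0 1 α y := fun y hy =>
    mul_pos (Real.rpow_pos_of_pos (abs_pos.2 (by linarith [hy.1])) _) (nullWeight_pos hy)
  rw [convOn, setIntegral_pos_iff_support_of_nonneg_ae]
  · have : Ioo (0 : ℝ) 1 ⊆ (Function.support fun y => |0 - y| ^ (1 - α) * nullWeight 0 1 α y) ∩
      Ioo 0 1 := fun y hy => ⟨(hpos y hy).ne', hy⟩
    refine lt_of_lt_of_le ?_ (measure_mono this)
    simp
  · filter_upwards [ae_restrict_mem measurableSet_Ioo] with y hy using (hpos y hy).le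
  · exact integrableOn_continuous_kernel (continuous_abs_rpow (by linarith))
      (integrableOn_nullWeight zero_lt_one hα0) 0

theorem integrableOn_pow_mul_nullWeight (hα0 : 0 < α) (n : ℕ) :
    IntegrableOn (fun y => y ^ n * nullWeight 0 1 α y) (Ioo 0 1) :=
  integrableOn_continuous_mul (by fun_prop) (integrableOn_nullWeight zero_lt_one hα0)

/-- The ladder sends P' to xP' - (1 - α)P plus a constant, so the leading coefficient is multiplied
by 1 - (1 - α)/(n + 1) = (n + α)/(n + 1). The power n + 1 meets degree n because the potential of w
itself is zero. -/
theorem convOn_pow_mul_nullWeight (hα0 : 0 < α) (hα : α < 1) (n : ℕ) :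
    ∃ p : ℝ[X], p.natDegree ≤ n ∧
      p.coeff n = -convOn (fun t => |t| ^ (1 - α)) 0 1 (nullWeight 0 1 α) 0 *
        ∏ i ∈ Finset.range n, ((i + α) / (i + 1)) ∧
      convOn (oddKernel α) 0 1 (fun y => y ^ (n + 1) * nullWeight 0 1 α y)
        =ᵐ[volume.restrict (Ioo 0 1)] fun x => p.eval x := by
  induction n with
  | zero =>
    refine ⟨C (-convOn (fun t => |t| ^ (1 - α)) 0 1 (nullWeight 0 1 α) 0), by simp, by simp, ?_⟩
    simpa using convOn_oddKernel_id_mul_nullWeight zero_lt_one hα0 hα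
  | succ n ih =>
    obtain ⟨p, hp, hc, h⟩ := ih
    obtain ⟨P, hP, hdeg⟩ := exists_antiderivative p
    subst hP
    have hPd := hdeg n hp
    have h' := convOn_oddKernel_id_mul_of_eval hα (integrableOn_pow_mul_nullWeight hα0 (n + 1)) h
    -- The integration constant affects neither the degree bound nor the coefficient of degree n +
    -- 1.
    generalize convOn (fun t => |t| ^ (1 - α)) 0 1 (fun y => y ^ (n + 1) * nullWeight 0 1 α y) 0 -
      (1 - α) * eval 0 P = s at h'
    refine ⟨X * derivative P - C s - C (1 - α) * P, ?_, ?_, ?_⟩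
    rotate_left 2
    · refine EventuallyEq.trans (EventuallyEq.of_eq (congrArg _ ?_)) h'
      funext y; ring
    · refine (natDegree_sub_le _ _).trans (max_le ((natDegree_sub_le _ _).trans
        (max_le ?_ (by simp))) ?_)
      · exact natDegree_mul_le.trans (by rw [natDegree_X]; omega)
      · exact (natDegree_C_mul_le _ _).trans hPd
    · have h1 : P.coeff (n + 1) * (n + 1) = P.derivative.coeff n := by rw [coeff_derivative]
      rw [coeff_sub, coeff_sub, coeff_X_mul, coeff_C_succ, coeff_C_mul, sub_zero,
        Finset.prod_range_succ, ← mul_assoc, ← hc, ← h1]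
      have : (n : ℝ) + 1 ≠ 0 := by positivity
      field_simp
      ring

/-- Since ρ = x(1 - x)w, ρyⁿ is the difference of two consecutive cases of the preceding lemma, and
the higher one supplies the leading coefficient. -/
theorem convOn_jacobiWeight_mul_pow (hα0 : 0 < α) (hα : α < 1) (n : ℕ) :
    ∃ r : ℝ[X], r.natDegree ≤ n + 1 ∧
      r.coeff (n + 1) = convOn (fun t => |t| ^ (1 - α)) 0 1 (nullWeight 0 1 α) 0 *
        ∏ i ∈ Finset.range (n + 1), ((i + α) / (i + 1)) ∧
      convOn (oddKernel α) 0 1 (fun y => jacobiWeight α y * y ^ n)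
        =ᵐ[volume.restrict (Ioo 0 1)] fun x => r.eval x := by
  obtain ⟨p, hp, hpc, hpe⟩ := convOn_pow_mul_nullWeight hα0 hα n
  obtain ⟨q, hq, hqc, hqe⟩ := convOn_pow_mul_nullWeight hα0 hα (n + 1)
  refine ⟨p - q, (natDegree_sub_le _ _).trans (max_le (hp.trans (Nat.le_succ n)) hq), ?_, ?_⟩
  · rw [coeff_sub, hqc, coeff_eq_zero_of_natDegree_lt (Nat.lt_succ_of_le hp)]
    ring
  · have e : (fun y => jacobiWeight α y * y ^ n) =ᵐ[volume.restrict (Ioo 0 1)] fun y =>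
        y ^ (n + 1) * nullWeight 0 1 α y + (-1) * (y ^ (n + 1 + 1) * nullWeight 0 1 α y) := by
      filter_upwards [ae_restrict_mem measurableSet_Ioo] with y hy
      rw [jacobiWeight_eq hy]; ring
    rw [convOn_congr_ae e]
    filter_upwards [hpe, hqe, convOn_add_ae (locallyIntegrable_oddKernel hα)
      (integrableOn_pow_mul_nullWeight hα0 (n + 1))
      ((integrableOn_pow_mul_nullWeight hα0 (n + 1 + 1)).const_mul (-1))] with x h1 h2 h3
    rw [h3, convOn_const_mul, h1, h2, eval_sub]
    ring

theorem Gamma_add_nat_eq (hα0 : 0 < α) (N : ℕ) :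
    Real.Gamma (N + α) =
      Real.Gamma α * Real.Gamma (N + 1) * ∏ i ∈ Finset.range N, ((i + α) / (i + 1)) := by
  induction N with
  | zero => simp
  | succ N ih =>
    have h1 : (N : ℝ) + 1 ≠ 0 := by positivity
    have h2 : (N : ℝ) + α ≠ 0 := by positivity
    rw [Finset.prod_range_succ]
    push_cast
    rw [Real.Gamma_add_one h1, show (N : ℝ) + 1 + α = N + α + 1 by ring, Real.Gamma_add_one h2, ih]
    field_simp

/-- The constant by which the derivative of the odd potential of `jacobiWeight α * p` differs
from the ratios `Γ(n + 1 + α) / Γ(n + 1)`. -/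
def potentialConst (α : ℝ) : ℝ :=
  convOn (fun t => |t| ^ (1 - α)) 0 1 (nullWeight 0 1 α) 0 / Real.Gamma α

theorem potentialConst_pos (hα0 : 0 < α) (hα : α < 1) : 0 < potentialConst α :=
  div_pos (convOn_abs_rpow_nullWeight_pos hα0 hα) (Real.Gamma_pos_of_pos hα0)

/-- The odd potential of a weighted polynomial is a polynomial of one degree more. -/
theorem convOn_jacobiWeight_mul_eval (hα0 : 0 < α) (hα : α < 1) (q : ℝ[X]) {n : ℕ}
    (hq : q.natDegree ≤ n) :
    ∃ r : ℝ[X], r.natDegree ≤ n + 1 ∧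
      r.derivative.coeff n =
        q.coeff n * (potentialConst α * (Real.Gamma (n + 1 + α) / Real.Gamma (n + 1))) ∧
      convOn (oddKernel α) 0 1 (fun y => jacobiWeight α y * q.eval y)
        =ᵐ[volume.restrict (Ioo 0 1)] fun x => r.eval x := by
  choose r hr hrc hre using convOn_jacobiWeight_mul_pow hα0 hα
  have hsum : ∀ N, convOn (oddKernel α) 0 1
      (fun y => jacobiWeight α y * ∑ i ∈ Finset.range N, q.coeff i * y ^ i)
      =ᵐ[volume.restrict (Ioo 0 1)]
        fun x => (∑ i ∈ Finset.range N, C (q.coeff i) * r i).eval x := by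
    intro N
    induction N with
    | zero =>
      refine ae_of_all _ fun x => ?_
      simp [convOn]
    | succ N ih =>
      have hi1 : IntegrableOn (fun y => jacobiWeight α y *
          ∑ i ∈ Finset.range N, q.coeff i * y ^ i) (Ioo 0 1) :=
        integrableOn_jacobiWeight_mul hα0 (by fun_prop)
      have hi2 : IntegrableOn (fun y => jacobiWeight α y * y ^ N) (Ioo 0 1) :=
        integrableOn_jacobiWeight_mul hα0 (by fun_prop)
      have e : (fun y => jacobiWeight α y * ∑ i ∈ Finset.range (N + 1), q.coeff i * y ^ i) =
          fun y => jacobiWeight α y * (∑ i ∈ Finset.range N, q.coeff i * y ^ i) +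
            q.coeff N * (jacobiWeight α y * y ^ N) := by
        funext y
        rw [Finset.sum_range_succ]; ring
      rw [e]
      filter_upwards [ih, hre N, convOn_add_ae (locallyIntegrable_oddKernel hα) hi1
        (hi2.const_mul (q.coeff N))] with x h1 h2 h3
      rw [h3, convOn_const_mul, h1, h2, Finset.sum_range_succ, eval_add, eval_mul, eval_C]
  refine ⟨∑ i ∈ Finset.range (n + 1), C (q.coeff i) * r i, ?_, ?_, ?_⟩
  · refine natDegree_sum_le_of_forall_le _ _ fun i hi => (natDegree_C_mul_le _ _).trans ?_
    have := Finset.mem_range.1 hi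
    exact (hr i).trans (by omega)
  -- Only i = n reaches degree n + 1, and the factor n + 1 from differentiation reduces Γ(n + 2) to
  -- Γ(n + 1).
  · rw [coeff_derivative, finsetSum_coeff, Finset.sum_range_succ, Finset.sum_eq_zero, zero_add,
      coeff_C_mul, hrc, potentialConst]
    · have h := Gamma_add_nat_eq hα0 (n + 1)
      have h1 : (n : ℝ) + 1 ≠ 0 := by positivity
      push_cast at h
      rw [h, Real.Gamma_add_one h1]
      have h2 : Real.Gamma ((n : ℝ) + 1) ≠ 0 := (Real.Gamma_pos_of_pos (by positivity)).ne'
      have h3 : Real.Gamma α ≠ 0 := (Real.Gamma_pos_of_pos hα0).ne'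
      field_simp
    · intro i hi
      have := Finset.mem_range.1 hi
      rw [coeff_C_mul, coeff_eq_zero_of_natDegree_lt ((hr i).trans_lt (by omega)), mul_zero]
  · refine EventuallyEq.trans (EventuallyEq.of_eq (congrArg _ ?_)) (hsum (n + 1))
    funext y
    rw [eval_eq_sum_range' (Nat.lt_succ_of_le hq)]

/-- The polynomial whose product with `nullWeight 0 1 α` is the derivative of
`jacobiWeight α * p`. -/
def weightedDeriv (α : ℝ) (p : ℝ[X]) : ℝ[X] :=
  C (α / 2) * (1 - C 2 * X) * p + X * (1 - X) * p.derivative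

theorem hasDerivAt_jacobiWeight_mul_eval (p : ℝ[X]) {x : ℝ} (hx : x ∈ Ioo (0 : ℝ) 1) :
    HasDerivAt (fun x => jacobiWeight α x * p.eval x)
      ((weightedDeriv α p).eval x * nullWeight 0 1 α x) x := by
  refine ((hasDerivAt_jacobiWeight hx).mul (p.hasDerivAt x)).congr_deriv ?_
  rw [jacobiWeight_eq hx, weightedDeriv]
  simp only [eval_add, eval_mul, eval_C, eval_sub, eval_one, eval_X]
  ring

theorem integrableOn_weightedDeriv (hα0 : 0 < α) (p : ℝ[X]) :
    IntegrableOn (fun x => (weightedDeriv α p).eval x * nullWeight 0 1 α x) (Ioo 0 1) :=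
  integrableOn_continuous_mul (weightedDeriv α p).continuous
    (integrableOn_nullWeight zero_lt_one hα0)

/-- Integration by parts in y, with no boundary terms because ρ vanishes at 0 and 1. It replaces the
odd kernel by the symmetric |t|^(1 - α) acting on (ρp)'; the point y = x is a countable exception.
-/
theorem convOn_oddKernel_jacobiWeight_mul (hα0 : 0 < α) (hα : α < 1) (p : ℝ[X]) :
    convOn (oddKernel α) 0 1 (fun y => jacobiWeight α y * p.eval y)
      =ᵐ[volume.restrict (Ioo 0 1)] fun x => 1 / (1 - α) * convOn (fun t => |t| ^ (1 - α)) 0 1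
        (fun x => (weightedDeriv α p).eval x * nullWeight 0 1 α x) x := by
  have hc := continuous_abs_rpow (by linarith : 0 ≤ 1 - α)
  filter_upwards [ae_integrableOn_kernel (locallyIntegrable_oddKernel hα)
    (integrableOn_jacobiWeight_mul hα0 p.continuous), ae_restrict_mem measurableSet_Ioo]
    with x hi hx
  have hi2 := integrableOn_continuous_kernel hc (integrableOn_weightedDeriv hα0 p) x
  have hd : ∀ y ∈ Ioo (0 : ℝ) 1 \ {x}, HasDerivAt
      (fun y => |x - y| ^ (1 - α) * (jacobiWeight α y * p.eval y))
      (-(1 - α) * (oddKernel α (x - y) * (jacobiWeight α y * p.eval y)) +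
        |x - y| ^ (1 - α) * ((weightedDeriv α p).eval y * nullWeight 0 1 α y)) y := by
    intro y hy
    have h1 := (hasDerivAt_abs_rpow (α := α) (sub_ne_zero.2 (Ne.symm hy.2))).comp y
      ((hasDerivAt_id' y).const_sub x)
    refine (h1.mul (hasDerivAt_jacobiWeight_mul_eval p hy.1)).congr_deriv ?_
    simp only [Function.comp]
    ring
  have h := integral_eq_of_hasDerivAt_off_countable_of_le _ _ zero_le_one (countable_singleton x)
    (Continuous.continuousOn (by
      have h1 := continuous_jacobiWeight hα0
      have h2 := p.continuous
      have h3 : Continuous fun y => |x - y| ^ (1 - α) := hc.comp (by fun_prop)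
      fun_prop)) hd
    ((intervalIntegrable_iff_integrableOn_Ioo_of_le zero_le_one).2
      ((hi.const_mul _).add hi2))
  rw [jacobiWeight_zero hα0, jacobiWeight_one hα0, intervalIntegral.integral_of_le zero_le_one,
    integral_Ioc_eq_integral_Ioo, integral_add (hi.const_mul _) hi2, integral_const_mul] at h
  have h0 : 1 - α ≠ 0 := by linarith
  simp only [convOn]
  rw [eq_comm, one_div, inv_mul_eq_iff_eq_mul₀ h0]
  linarith

theorem integral_jacobiWeight_mul_derivative (hα0 : 0 < α) (p r : ℝ[X]) :
    ∫ x in Ioo (0 : ℝ) 1, jacobiWeight α x * p.eval x * r.derivative.eval x =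
      -∫ x in Ioo (0 : ℝ) 1, (weightedDeriv α p).eval x * nullWeight 0 1 α x * r.eval x := by
  have hi1 : IntegrableOn (fun x => jacobiWeight α x * p.eval x * r.derivative.eval x)
      (Ioo 0 1) :=
    integrableOn_jacobiWeight_mul_mul hα0 p.continuous r.derivative.continuous
  have hi2 : IntegrableOn (fun x => (weightedDeriv α p).eval x * nullWeight 0 1 α x * r.eval x)
      (Ioo 0 1) := by
    have := integrableOn_continuous_mul r.continuous (integrableOn_weightedDeriv hα0 p)
    simpa only [mul_comm] using this
  have h := integral_eq_of_hasDerivAt_off_countable_of_le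
    (fun x => jacobiWeight α x * p.eval x * r.eval x)
    (fun x => (weightedDeriv α p).eval x * nullWeight 0 1 α x * r.eval x +
      jacobiWeight α x * p.eval x * r.derivative.eval x) zero_le_one countable_empty
    (Continuous.continuousOn (by
      have h1 := continuous_jacobiWeight hα0
      have h2 := p.continuous
      have h3 := r.continuous
      fun_prop))
    (fun x hx => (hasDerivAt_jacobiWeight_mul_eval p hx.1).mul (r.hasDerivAt x))
    ((intervalIntegrable_iff_integrableOn_Ioo_of_le zero_le_one).2 (hi2.add hi1))
  rw [jacobiWeight_zero hα0, jacobiWeight_one hα0, intervalIntegral.integral_of_le zero_le_one,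
    integral_Ioc_eq_integral_Ioo, integral_add hi2 hi1] at h
  linarith

theorem integral_mul_convOn_abs_rpow_comm {f g : ℝ → ℝ} (hα : α < 1)
    (hf : IntegrableOn f (Ioo 0 1)) (hg : IntegrableOn g (Ioo 0 1)) :
    ∫ x in Ioo (0 : ℝ) 1, f x * convOn (fun t => |t| ^ (1 - α)) 0 1 g x =
      ∫ x in Ioo (0 : ℝ) 1, g x * convOn (fun t => |t| ^ (1 - α)) 0 1 f x := by
  have hc := continuous_abs_rpow (by linarith : 0 ≤ 1 - α)
  have hint : Integrable (fun p : ℝ × ℝ => |p.1 - p.2| ^ (1 - α) * (f p.1 * g p.2))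
      ((volume.restrict (Ioo 0 1)).prod (volume.restrict (Ioo 0 1))) := by
    have hcc : Continuous fun p : ℝ × ℝ => |p.1 - p.2| ^ (1 - α) := hc.comp (by fun_prop)
    refine (hf.mul_prod hg).bdd_mul (c := 1) hcc.aestronglyMeasurable ?_
    rw [Measure.prod_restrict]
    filter_upwards [ae_restrict_mem (measurableSet_Ioo.prod measurableSet_Ioo)] with p hp
    obtain ⟨⟨h1, h2⟩, h3, h4⟩ := hp
    rw [Real.norm_of_nonneg (Real.rpow_nonneg (abs_nonneg _) _)]
    exact Real.rpow_le_one (abs_nonneg _) (abs_le.2 ⟨by linarith, by linarith⟩) (by linarith)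
  have e := integral_integral_swap (f := fun x y => |x - y| ^ (1 - α) * (f x * g y)) hint
  simp only [convOn, ← integral_const_mul]
  have e1 : ∀ x y, f x * (|x - y| ^ (1 - α) * g y) = |x - y| ^ (1 - α) * (f x * g y) :=
    fun x y => by ring
  have e2 : ∀ x y, g x * (|x - y| ^ (1 - α) * f y) = |y - x| ^ (1 - α) * (f y * g x) :=
    fun x y => by rw [abs_sub_comm]; ring
  simp only [e1, e2]
  exact e

/-- Symmetry of `p ↦ r'`, where `r` is the odd potential of `jacobiWeight α * p`. -/
theorem integral_jacobiWeight_mul_potential_symm (hα0 : 0 < α) (hα : α < 1) {p q r s : ℝ[X]}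
    (hr : convOn (oddKernel α) 0 1 (fun y => jacobiWeight α y * p.eval y)
      =ᵐ[volume.restrict (Ioo 0 1)] fun x => r.eval x)
    (hs : convOn (oddKernel α) 0 1 (fun y => jacobiWeight α y * q.eval y)
      =ᵐ[volume.restrict (Ioo 0 1)] fun x => s.eval x) :
    ∫ x in Ioo (0 : ℝ) 1, jacobiWeight α x * q.eval x * r.derivative.eval x =
      ∫ x in Ioo (0 : ℝ) 1, jacobiWeight α x * p.eval x * s.derivative.eval x := by
  -- Both sides equal -(1 - α)⁻¹∬|x - y|^(1 - α)(ρp)'(ρq)', which is visibly symmetric in p and q.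
  have key : ∀ {p q r : ℝ[X]}, convOn (oddKernel α) 0 1 (fun y => jacobiWeight α y * p.eval y)
      =ᵐ[volume.restrict (Ioo 0 1)] (fun x => r.eval x) →
      ∫ x in Ioo (0 : ℝ) 1, (weightedDeriv α q).eval x * nullWeight 0 1 α x * r.eval x =
        1 / (1 - α) * ∫ x in Ioo (0 : ℝ) 1, (weightedDeriv α q).eval x * nullWeight 0 1 α x *
          convOn (fun t => |t| ^ (1 - α)) 0 1
            (fun x => (weightedDeriv α p).eval x * nullWeight 0 1 α x) x := by
    intro p q r hr
    rw [← integral_const_mul]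
    refine integral_congr_ae ?_
    filter_upwards [hr, convOn_oddKernel_jacobiWeight_mul hα0 hα p] with x h1 h2
    rw [← h1, h2]; ring
  rw [integral_jacobiWeight_mul_derivative hα0, integral_jacobiWeight_mul_derivative hα0, key hr,
    key hs, integral_mul_convOn_abs_rpow_comm hα (integrableOn_weightedDeriv hα0 q)
      (integrableOn_weightedDeriv hα0 p)]

end PolynomialImages

/-! ### Jacobi polynomials: orthogonality and the eigenvalue relation -/

section JacobiPolynomial

open Polynomial

variable {α : ℝ}

/-- The Jacobi polynomial `jacobiG α n` as an element of `ℝ[X]`. -/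
def jacobiPoly (α : ℝ) (n : ℕ) : ℝ[X] :=
  ∑ k ∈ Finset.range (n + 1), C (jacobiCoeff α n k) * X ^ k

theorem eval_jacobiPoly (α : ℝ) (n : ℕ) (x : ℝ) : (jacobiPoly α n).eval x = jacobiG α n x := by
  simp [jacobiPoly, jacobiG, eval_finsetSum]

theorem coeff_jacobiPoly (α : ℝ) (n k : ℕ) :
    (jacobiPoly α n).coeff k = if k ≤ n then jacobiCoeff α n k else 0 := by
  simp only [jacobiPoly, finsetSum_coeff, coeff_C_mul_X_pow]
  rw [Finset.sum_ite_eq]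
  simp

theorem natDegree_jacobiPoly_le (α : ℝ) (n : ℕ) : (jacobiPoly α n).natDegree ≤ n :=
  natDegree_le_iff_coeff_eq_zero.2 fun k hk => by
    rw [coeff_jacobiPoly, if_neg (by omega)]

theorem jacobiCoeff_self_ne_zero (hα0 : 0 < α) (n : ℕ) : jacobiCoeff α n n ≠ 0 := by
  have h : ∀ z : ℝ, 0 < z → Real.Gamma z ≠ 0 := fun z hz => (Real.Gamma_pos_of_pos hz).ne'
  rw [jacobiCoeff, sub_self]
  refine div_ne_zero (mul_ne_zero (mul_ne_zero (pow_ne_zero _ (by norm_num)) (h _ (by positivity)))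
    (h _ (by positivity))) (mul_ne_zero (mul_ne_zero (mul_ne_zero (h _ (by positivity))
    (h _ (by norm_num))) (h _ (by positivity))) (h _ (by positivity)))

theorem jacobiPoly_ne_zero (hα0 : 0 < α) (n : ℕ) : jacobiPoly α n ≠ 0 := fun h => by
  have := coeff_jacobiPoly α n n
  rw [h, coeff_zero, if_pos le_rfl] at this
  exact jacobiCoeff_self_ne_zero hα0 n this.symm

theorem Gamma_add_nat_eq_ascPochhammer {z : ℝ} (hz : 0 < z) (m : ℕ) :
    Real.Gamma (z + m) = (ascPochhammer ℝ m).eval z * Real.Gamma z := by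
  induction m with
  | zero => simp
  | succ m ih =>
    rw [ascPochhammer_succ_eval, Nat.cast_succ, ← add_assoc,
      Real.Gamma_add_one (by positivity), ih]
    ring

theorem integral_rpow_mul_rpow {s t : ℝ} (hs : 0 < s) (ht : 0 < t) :
    ∫ x in Ioo (0 : ℝ) 1, x ^ (s - 1) * (1 - x) ^ (t - 1) =
      Real.Gamma s * Real.Gamma t / Real.Gamma (s + t) := by
  have h := ProbabilityTheory.beta_eq_betaIntegralReal s t hs ht
  rw [ProbabilityTheory.beta] at h
  rw [h, Complex.betaIntegral, intervalIntegral.integral_of_le (by norm_num),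
    ← integral_Ioc_eq_integral_Ioo, ← RCLike.re_to_complex, ← integral_re]
  · refine setIntegral_congr_fun measurableSet_Ioc fun x ⟨hx1, hx₂⟩ ↦ ?_
    norm_cast
    rw [← Complex.ofReal_cpow, ← Complex.ofReal_cpow, RCLike.re_to_complex,
      Complex.re_mul_ofReal, Complex.ofReal_re]
    all_goals linarith
  · have := Complex.betaIntegral_convergent (u := s) (v := t) (by simpa) (by simpa)
    rwa [intervalIntegrable_iff_integrableOn_Ioc_of_le (by simp), IntegrableOn] at this

theorem integral_jacobiWeight_mul_pow (hα0 : 0 < α) (k : ℕ) :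
    ∫ x in Ioo (0 : ℝ) 1, jacobiWeight α x * x ^ k =
      Real.Gamma (k + α / 2 + 1) * Real.Gamma (α / 2 + 1) / Real.Gamma (k + α + 2) := by
  have h := integral_rpow_mul_rpow (s := k + α / 2 + 1) (t := α / 2 + 1) (by positivity)
    (by positivity)
  rw [show (k : ℝ) + α / 2 + 1 + (α / 2 + 1) = k + α + 2 by ring] at h
  rw [← h]
  refine setIntegral_congr_fun measurableSet_Ioo fun x hx => ?_
  simp only [jacobiWeight]
  rw [add_sub_cancel_right, add_sub_cancel_right, add_comm (k : ℝ), Real.rpow_add_natCast hx.1.ne']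
  ring

/-- These are the Beta-integral moments of ρG_n. Once the Gamma factors cancel, the sum is a
multiple of the n-th finite difference of a polynomial of degree n - 1. -/
theorem sum_jacobiCoeff_mul_Gamma_eq_zero (hα0 : 0 < α) {n m : ℕ} (hm : m < n) :
    ∑ k ∈ Finset.range (n + 1), jacobiCoeff α n k *
      (Real.Gamma ((k + m : ℕ) + α / 2 + 1) * Real.Gamma (α / 2 + 1) /
        Real.Gamma ((k + m : ℕ) + α + 2)) = 0 := by
  obtain ⟨j, rfl⟩ := Nat.exists_eq_add_of_lt hm
  set n := m + j + 1 with hn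
  -- The factors are Γ(k + m + α/2 + 1)/Γ(k + α/2 + 1) and Γ(n + k + α + 1)/Γ(k + m + α + 2),
  -- polynomials in k of degrees m and j = n - m - 1.
  set P : ℝ[X] := (ascPochhammer ℝ m).comp (X + C (α / 2 + 1)) *
    (ascPochhammer ℝ j).comp (X + C (m + α + 2)) with hP
  have hPd : P.natDegree < n := by
    refine lt_of_le_of_lt natDegree_mul_le ?_
    rw [natDegree_comp, natDegree_comp, ascPochhammer_natDegree, ascPochhammer_natDegree,
      natDegree_X_add_C, natDegree_X_add_C]
    omega
  have h0 := congrFun (fwdDiff_iter_eq_zero_of_degree_lt hPd) 0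
  rw [fwdDiff_iter_eq_sum_shift] at h0
  have hterm : ∀ k ∈ Finset.range (n + 1), jacobiCoeff α n k *
      (Real.Gamma ((k + m : ℕ) + α / 2 + 1) * Real.Gamma (α / 2 + 1) /
        Real.Gamma ((k + m : ℕ) + α + 2)) =
      Real.Gamma (n + α / 2 + 1) * Real.Gamma (α / 2 + 1) /
        (Real.Gamma (n + α + 1) * Real.Gamma (n + 1)) *
      (((-1 : ℤ) ^ (n - k) * n.choose k) • P.eval (0 + k • (1 : ℝ))) := by
    intro k hk
    have hkn : k ≤ n := Nat.lt_succ_iff.1 (Finset.mem_range.1 hk)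
    have e1 : Real.Gamma ((k + m : ℕ) + α / 2 + 1) =
        (ascPochhammer ℝ m).eval (k + (α / 2 + 1)) * Real.Gamma (k + α / 2 + 1) := by
      have := Gamma_add_nat_eq_ascPochhammer (z := k + (α / 2 + 1)) (by positivity) m
      rw [show (k : ℝ) + α / 2 + 1 = k + (α / 2 + 1) by ring, ← this]
      congr 1; push_cast; ring
    have e2 : Real.Gamma (n + k + α + 1) =
        (ascPochhammer ℝ j).eval (k + (m + α + 2)) * Real.Gamma ((k + m : ℕ) + α + 2) := by
      have := Gamma_add_nat_eq_ascPochhammer (z := k + (m + α + 2)) (by positivity) j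
      rw [show ((k + m : ℕ) : ℝ) + α + 2 = k + (m + α + 2) by push_cast; ring, ← this]
      congr 1; rw [hn]; push_cast; ring
    have e3 : Real.Gamma ((n : ℝ) - k + 1) = ((n - k).factorial : ℝ) := by
      rw [← Real.Gamma_nat_eq_factorial, Nat.cast_sub hkn]
    have e4 : (-1 : ℝ) ^ (n + k) = (-1) ^ (n - k) := by
      rw [show n + k = (n - k) + 2 * k by omega, pow_add, pow_mul]; simp
    have e5 : (n.choose k : ℝ) = n.factorial / (k.factorial * (n - k).factorial) :=
      Nat.cast_choose ℝ hkn
    have hP' : P.eval (0 + k • (1 : ℝ)) = (ascPochhammer ℝ m).eval (k + (α / 2 + 1)) *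
        (ascPochhammer ℝ j).eval (k + (m + α + 2)) := by
      simp [hP, eval_mul, eval_comp]
    have g1 : Real.Gamma (k + α / 2 + 1) ≠ 0 := (Real.Gamma_pos_of_pos (by positivity)).ne'
    have g2 : Real.Gamma ((k + m : ℕ) + α + 2) ≠ 0 := (Real.Gamma_pos_of_pos (by positivity)).ne'
    have g3 : Real.Gamma (n + α + 1) ≠ 0 := (Real.Gamma_pos_of_pos (by positivity)).ne'
    rw [jacobiCoeff, e1, e2, e3, e4, hP', zsmul_eq_mul, Real.Gamma_nat_eq_factorial,
      Real.Gamma_nat_eq_factorial]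
    push_cast
    rw [e5]
    have g4 : (n.factorial : ℝ) ≠ 0 := by positivity
    have g5 : (k.factorial : ℝ) ≠ 0 := by positivity
    have g6 : ((n - k).factorial : ℝ) ≠ 0 := by positivity
    push_cast at g2
    field_simp
  rw [Finset.sum_congr rfl hterm, ← Finset.mul_sum, h0]
  simp

theorem integral_jacobiWeight_mul_pow_mul_jacobiPoly (hα0 : 0 < α) {n m : ℕ} (hm : m < n) :
    ∫ x in Ioo (0 : ℝ) 1, jacobiWeight α x * x ^ m * (jacobiPoly α n).eval x = 0 := by
  refine Eq.trans ?_ (sum_jacobiCoeff_mul_Gamma_eq_zero hα0 hm)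
  simp only [← integral_jacobiWeight_mul_pow hα0, ← integral_const_mul]
  rw [← integral_finsetSum _ fun k _ =>
    (integrableOn_jacobiWeight_mul hα0 (by fun_prop)).const_mul _]
  congr 1; funext x
  rw [eval_jacobiPoly, jacobiG, Finset.mul_sum]
  exact Finset.sum_congr rfl fun k _ => by ring

theorem integral_jacobiWeight_mul_mul_jacobiPoly (hα0 : 0 < α) {n : ℕ} {q : ℝ[X]}
    (hq : q.degree < n) :
    ∫ x in Ioo (0 : ℝ) 1, jacobiWeight α x * q.eval x * (jacobiPoly α n).eval x = 0 := by
  by_cases h0 : q = 0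
  · simp [h0]
  have hd : q.natDegree < n := (natDegree_lt_iff_degree_lt h0).2 hq
  have e : ∀ x, jacobiWeight α x * q.eval x * (jacobiPoly α n).eval x =
      ∑ i ∈ Finset.range n, q.coeff i * (jacobiWeight α x * x ^ i * (jacobiPoly α n).eval x) := by
    intro x
    rw [eval_eq_sum_range' hd, Finset.mul_sum, Finset.sum_mul]
    exact Finset.sum_congr rfl fun k _ => by ring
  simp only [e]
  rw [integral_finsetSum _ fun k _ => 
    (integrableOn_jacobiWeight_mul_mul hα0 (continuous_pow k) (jacobiPoly α n).continuous).const_mul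
      _]
  refine Finset.sum_eq_zero fun i hi => ?_
  rw [integral_const_mul, integral_jacobiWeight_mul_pow_mul_jacobiPoly hα0 (Finset.mem_range.1 hi),
    mul_zero]

theorem integral_jacobiWeight_mul_jacobiG_mul_jacobiG (hα0 : 0 < α) {n m : ℕ} (h : n ≠ m) :
    ∫ x in Ioo (0 : ℝ) 1, jacobiWeight α x * jacobiG α n x * jacobiG α m x = 0 := by
  have key : ∀ {n m : ℕ}, n < m →
      ∫ x in Ioo (0 : ℝ) 1, jacobiWeight α x * jacobiG α n x * jacobiG α m x = 0 := by
    intro n m h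
    simp only [← eval_jacobiPoly]
    refine integral_jacobiWeight_mul_mul_jacobiPoly hα0 ?_
    exact (degree_le_of_natDegree_le (natDegree_jacobiPoly_le α n)).trans_lt (by exact_mod_cast h)
  rcases h.lt_or_gt with h | h
  · exact key h
  · refine Eq.trans ?_ (key h)
    congr 1; funext x; ring

/-- Let A p = (T(ρp))' and D = A G_n - λG_n. The degree of D is below n, and A does not raise
degrees, so symmetry in L²(ρ) gives ‖D‖² = ⟨AD, G_n⟩ - λ⟨D, G_n⟩ = 0. That r has exact degree n + 1
drives the moment recursion in the uniqueness proof. -/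
theorem exists_potential_jacobiPoly (hα0 : 0 < α) (hα : α < 1) (n : ℕ) :
    ∃ r : ℝ[X], r.natDegree ≤ n + 1 ∧ r.coeff (n + 1) ≠ 0 ∧
      r.derivative = C (potentialConst α * (Real.Gamma (n + 1 + α) / Real.Gamma (n + 1))) *
        jacobiPoly α n ∧
      convOn (oddKernel α) 0 1 (fun y => jacobiWeight α y * (jacobiPoly α n).eval y)
        =ᵐ[volume.restrict (Ioo 0 1)] fun x => r.eval x := by
  obtain ⟨r, hr, hrc, hre⟩ :=
    convOn_jacobiWeight_mul_eval hα0 hα (jacobiPoly α n) (natDegree_jacobiPoly_le α n)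
  set lam := potentialConst α * (Real.Gamma (n + 1 + α) / Real.Gamma (n + 1)) with hlam
  have hlam0 : lam ≠ 0 := mul_ne_zero (potentialConst_pos hα0 hα).ne'
    (div_ne_zero (Real.Gamma_pos_of_pos (by positivity)).ne'
      (Real.Gamma_pos_of_pos (by positivity)).ne')
  have hc : (jacobiPoly α n).coeff n = jacobiCoeff α n n := by
    rw [coeff_jacobiPoly, if_pos le_rfl]
  refine ⟨r, hr, fun h => ?_, ?_, hre⟩
  · rw [coeff_derivative, h, zero_mul, hc] at hrc
    exact mul_ne_zero (jacobiCoeff_self_ne_zero hα0 n) hlam0 hrc.symm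
  -- The eigenvalue is chosen so that the coefficients of degree n cancel.
  have hD : (r.derivative - C lam * jacobiPoly α n).degree < n := by
    rw [degree_lt_iff_coeff_zero]
    intro m hm
    rw [coeff_sub, coeff_C_mul]
    rcases hm.eq_or_lt with rfl | hm
    · rw [hrc]; ring
    · rw [coeff_derivative, coeff_eq_zero_of_natDegree_lt (by omega),
        coeff_eq_zero_of_natDegree_lt ((natDegree_jacobiPoly_le α n).trans_lt hm)]
      ring
  set D := r.derivative - C lam * jacobiPoly α n with hDdef
  rw [← sub_eq_zero]
  change D = 0
  by_contra hD0
  have hDn : D.natDegree < n := (natDegree_lt_iff_degree_lt hD0).2 hD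
  obtain ⟨s, hs, -, hse⟩ :=
    convOn_jacobiWeight_mul_eval hα0 hα D (n := n - 1) (by omega)
  have hsd : s.derivative.degree < n := by
    rw [degree_lt_iff_coeff_zero]
    intro m hm
    rw [coeff_derivative, coeff_eq_zero_of_natDegree_lt (by omega), zero_mul]
  have h1 := integral_jacobiWeight_mul_potential_symm hα0 hα hre hse
  have h2 : ∫ x in Ioo (0 : ℝ) 1,
      jacobiWeight α x * (jacobiPoly α n).eval x * s.derivative.eval x = 0 := by
    refine Eq.trans ?_ (integral_jacobiWeight_mul_mul_jacobiPoly hα0 hsd)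
    congr 1; funext x; ring
  have h3 := integral_jacobiWeight_mul_mul_jacobiPoly hα0 hD
  refine hD0 (eq_zero_of_integral_jacobiWeight_mul_sq_eq_zero hα0 (p := D) ?_)
  have e : ∀ x, jacobiWeight α x * D.eval x ^ 2 = jacobiWeight α x * D.eval x *
      r.derivative.eval x - lam * (jacobiWeight α x * D.eval x * (jacobiPoly α n).eval x) := by
    intro x
    have : D.eval x = r.derivative.eval x - lam * (jacobiPoly α n).eval x := by
      rw [hDdef, eval_sub, eval_mul, eval_C]
    rw [sq, ← mul_assoc]
    nth_rewrite 2 [this]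
    ring
  have hi : ∀ p q : ℝ[X], IntegrableOn (fun x => jacobiWeight α x * p.eval x * q.eval x)
      (Ioo 0 1) := fun p q =>
    integrableOn_jacobiWeight_mul_mul hα0 p.continuous q.continuous
  simp only [e]
  rw [integral_sub (hi _ _) ((hi _ _).const_mul _), integral_const_mul, h1, h2, h3]
  ring

/-- The Jacobi functions diagonalize the Riesz derivative. -/
theorem integral_jacobiG_mul_rieszFracDeriv (hα0 : 0 < α) (hα : α < 1) (n : ℕ) {φ : ℝ → ℝ}
    (hφ : IsTestFunction 0 1 φ) :
    ∫ x in Ioo (0 : ℝ) 1, jacobiWeight α x * jacobiG α n x * rieszFracDeriv α φ x =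
      1 / (2 * Real.Gamma (1 - α)) * potentialConst α *
        (Real.Gamma (n + 1 + α) / Real.Gamma (n + 1)) *
        ∫ x in Ioo (0 : ℝ) 1, jacobiG α n x * φ x := by
  obtain ⟨r, -, -, hrd, hre⟩ := exists_potential_jacobiPoly hα0 hα n
  simp only [← eval_jacobiPoly]
  rw [integral_mul_rieszFracDeriv hα hφ
    (integrableOn_jacobiWeight_mul hα0 (jacobiPoly α n).continuous)]
  have h1 : ∫ x in Ioo (0 : ℝ) 1, convOn (oddKernel α) 0 1
      (fun y => jacobiWeight α y * (jacobiPoly α n).eval y) x * deriv φ x =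
      ∫ x in Ioo (0 : ℝ) 1, r.eval x * deriv φ x := by
    refine integral_congr_ae ?_
    filter_upwards [hre] with x hx
    rw [hx]
  rw [h1, hφ.integral_mul_deriv zero_lt_one (fun x _ => r.hasDerivAt x)
    r.derivative.continuous.continuousOn, hrd]
  simp only [eval_mul, eval_C, mul_assoc]
  rw [integral_const_mul, integral_const_mul]
  ring

end JacobiPolynomial

/-! ### Functions annihilated by the Riesz derivative -/

section Uniqueness

open Polynomial

variable {α : ℝ} {f : ℝ → ℝ}

/-- An integrable function on `(0, 1)` with vanishing moments is zero. -/
theorem ae_eq_zero_of_moments_eq_zero (hf : IntegrableOn f (Ioo 0 1))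
    (h : ∀ n : ℕ, ∫ x in Ioo (0 : ℝ) 1, x ^ n * f x = 0) :
    f =ᵐ[volume.restrict (Ioo 0 1)] fun _ => 0 := by
  have hpoly : ∀ p : ℝ[X], ∫ x in Ioo (0 : ℝ) 1, p.eval x * f x = 0 := by
    intro p
    simp only [eval_eq_sum_range, Finset.sum_mul]
    rw [integral_finsetSum _ fun i _ => integrableOn_continuous_mul (by fun_prop) hf]
    refine Finset.sum_eq_zero fun i _ => ?_
    simp only [mul_assoc]
    rw [integral_const_mul, h, mul_zero]
  have key := isOpen_Ioo.ae_eq_zero_of_integral_contDiff_smul_eq_zero (μ := volume) (U := Ioo 0 1)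
    hf.locallyIntegrableOn ?_
  · rw [EventuallyEq, ae_restrict_iff' measurableSet_Ioo]
    exact key
  intro g hg _ ht
  have hgz : ∀ x, x ∉ Ioo (0 : ℝ) 1 → g x • f x = 0 := fun x hx => by
    rw [image_eq_zero_of_notMem_tsupport fun h => hx (ht h), zero_smul]
  rw [← setIntegral_eq_integral_of_forall_compl_eq_zero hgz]
  simp only [smul_eq_mul]
  set I := ∫ x in Ioo (0 : ℝ) 1, |f x|
  have hI : 0 ≤ I := integral_nonneg fun _ => abs_nonneg _
  by_contra hne
  have hpos : 0 < |∫ x in Ioo (0 : ℝ) 1, g x * f x| := abs_pos.2 hne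
  -- Weierstrass approximation of g within δ bounds the integral by δI, while by this choice it
  -- equals δ(I + 1).
  set δ := |∫ x in Ioo (0 : ℝ) 1, g x * f x| / (I + 1) with hδ
  have hδ0 : 0 < δ := by positivity
  obtain ⟨p, hp⟩ := exists_polynomial_near_of_continuousOn 0 1 g hg.continuous.continuousOn δ hδ0
  have h1 : ∫ x in Ioo (0 : ℝ) 1, g x * f x = ∫ x in Ioo (0 : ℝ) 1, (g x - p.eval x) * f x := by
    simp only [sub_mul]
    rw [integral_sub (integrableOn_continuous_mul hg.continuous hf)
      (integrableOn_continuous_mul p.continuous hf), hpoly, sub_zero]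
  have h2 : |∫ x in Ioo (0 : ℝ) 1, g x * f x| ≤ δ * I := by
    rw [h1, ← integral_const_mul, ← Real.norm_eq_abs]
    refine norm_integral_le_of_norm_le (hf.abs.const_mul δ) ?_
    filter_upwards [ae_restrict_mem measurableSet_Ioo] with x hx
    rw [norm_mul, norm_sub_rev]
    exact mul_le_mul_of_nonneg_right (hp x (Ioo_subset_Icc_self hx)).le (abs_nonneg _)
  have h3 : |∫ x in Ioo (0 : ℝ) 1, g x * f x| = δ * (I + 1) := by
    rw [hδ]; field_simp
  nlinarith

theorem integral_jacobiWeight_mul_jacobiPoly_eq_zero (hα0 : 0 < α) {n : ℕ} (hn : 0 < n) :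
    ∫ x in Ioo (0 : ℝ) 1, jacobiWeight α x * (jacobiPoly α n).eval x = 0 := by
  simpa using integral_jacobiWeight_mul_pow_mul_jacobiPoly hα0 hn

/-- Antisymmetry moves T onto f, where it gives a constant, and ρG_n has mean zero for n ≥ 1. -/
theorem integral_potential_mul_eq_zero (hα0 : 0 < α) (hα : α < 1)
    (hf : IntegrableOn f (Ioo 0 1)) {C₀ : ℝ}
    (hT : convOn (oddKernel α) 0 1 f =ᵐ[volume.restrict (Ioo 0 1)] fun _ => C₀) {n : ℕ}
    (hn : 0 < n) {r : ℝ[X]}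
    (hr : convOn (oddKernel α) 0 1 (fun y => jacobiWeight α y * (jacobiPoly α n).eval y)
        =ᵐ[volume.restrict (Ioo 0 1)] fun x => r.eval x) :
    ∫ x in Ioo (0 : ℝ) 1, r.eval x * f x = 0 := by
  have hcont : Continuous fun y => jacobiWeight α y * (jacobiPoly α n).eval y :=
    (continuous_jacobiWeight hα0).mul (jacobiPoly α n).continuous
  obtain ⟨M, hM⟩ := (isCompact_Icc (a := (0 : ℝ)) (b := 1)).exists_bound_of_continuousOn
    hcont.continuousOn
  have h1 := integral_mul_convOn_oddKernel hα hf hcont.aestronglyMeasurable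
    fun x hx => hM x (Ioo_subset_Icc_self hx)
  have h2 : ∫ x in Ioo (0 : ℝ) 1, jacobiWeight α x * (jacobiPoly α n).eval x *
      convOn (oddKernel α) 0 1 f x = 0 := by
    have : ∫ x in Ioo (0 : ℝ) 1, jacobiWeight α x * (jacobiPoly α n).eval x *
      convOn (oddKernel α) 0 1 f x = ∫ x in Ioo (0 : ℝ) 1,
        jacobiWeight α x * (jacobiPoly α n).eval x * C₀ := by
      refine integral_congr_ae ?_
      filter_upwards [hT] with x hx
      rw [hx]
    rw [this, integral_mul_const, integral_jacobiWeight_mul_jacobiPoly_eq_zero hα0 hn, zero_mul]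
  rw [h2, eq_comm, neg_eq_zero] at h1
  refine Eq.trans (integral_congr_ae ?_) h1
  filter_upwards [hr] with x hx
  rw [← hx, mul_comm]

/-- A function with constant odd potential is determined by its first two moments. -/
theorem ae_eq_zero_of_convOn_const (hα0 : 0 < α) (hα : α < 1)
    (hf : IntegrableOn f (Ioo 0 1)) {C₀ : ℝ}
    (hT : convOn (oddKernel α) 0 1 f =ᵐ[volume.restrict (Ioo 0 1)] fun _ => C₀)
    (h0 : ∫ x in Ioo (0 : ℝ) 1, f x = 0) (h1 : ∫ x in Ioo (0 : ℝ) 1, x * f x = 0) :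
    f =ᵐ[volume.restrict (Ioo 0 1)] fun _ => 0 := by
  refine ae_eq_zero_of_moments_eq_zero hf fun n => ?_
  induction n using Nat.strong_induction_on with
  | _ n ih =>
    match n with
    | 0 => simpa using h0
    | 1 => simpa using h1
    | n + 2 =>
      -- The index n + 1 gives a polynomial of exact degree n + 2, so its orthogonality to f
      -- expresses the moment of order n + 2 through lower ones.
      obtain ⟨r, hrd, hrc, -, hre⟩ := exists_potential_jacobiPoly hα0 hα (n + 1)
      have h2 := integral_potential_mul_eq_zero hα0 hα hf hT n.succ_pos hre
      simp only [eval_eq_sum_range' (Nat.lt_succ_of_le hrd), Finset.sum_mul, mul_assoc] at h2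
      rw [integral_finsetSum _ fun i _ =>
        (integrableOn_continuous_mul (by fun_prop) hf).const_mul _, Finset.sum_range_succ,
        Finset.sum_eq_zero, zero_add, integral_const_mul] at h2
      · exact (mul_eq_zero.1 h2).resolve_left hrc
      · intro i hi
        rw [integral_const_mul, ih i (by simpa using hi), mul_zero]

/-- Subtract the null function (c + dy)w with the same first two moments as f; the difference still
has constant potential, so it vanishes. -/
theorem ae_eq_rieszNull_of_convOn_const (hα0 : 0 < α) (hα : α < 1)
    (hf : IntegrableOn f (Ioo 0 1)) {C₀ : ℝ}
    (hT : convOn (oddKernel α) 0 1 f =ᵐ[volume.restrict (Ioo 0 1)] fun _ => C₀) :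
    ∃ c₁ c₂, f =ᵐ[volume.restrict (Ioo 0 1)] rieszNull 0 1 α c₁ c₂ := by
  set w := nullWeight 0 1 α with hw
  have hwi : IntegrableOn w (Ioo 0 1) := integrableOn_nullWeight zero_lt_one hα0
  have hyw : IntegrableOn (fun y => y * w y) (Ioo 0 1) := integrableOn_continuous_mul continuous_id hwi
  have hyyw : IntegrableOn (fun y => y ^ 2 * w y) (Ioo 0 1) :=
    integrableOn_continuous_mul (by fun_prop) hwi
  have hyf : IntegrableOn (fun y => y * f y) (Ioo 0 1) := integrableOn_continuous_mul continuous_id hf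
  have hposint : ∀ g : ℝ → ℝ, IntegrableOn (fun y => g y * w y) (Ioo 0 1) → (∀ y, 0 ≤ g y) →
      (∀ᵐ y ∂(volume : Measure ℝ), g y ≠ 0) → 0 < ∫ y in Ioo (0 : ℝ) 1, g y * w y := by
    intro g hg hg0 hgne
    have hnn : 0 ≤ᵐ[volume.restrict (Ioo (0 : ℝ) 1)] fun y => g y * w y := by
      filter_upwards [ae_restrict_mem measurableSet_Ioo] with y hy
      exact mul_nonneg (hg0 y) (nullWeight_pos hy).le
    refine lt_of_le_of_ne (integral_nonneg_of_ae hnn) fun h => ?_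
    have h1 := (setIntegral_eq_zero_iff_of_nonneg_ae hnn hg).1 h.symm
    have h2 : ∀ᵐ y ∂(volume.restrict (Ioo (0 : ℝ) 1)), False := by
      filter_upwards [h1, ae_restrict_of_ae hgne, ae_restrict_mem measurableSet_Ioo] with y a b c
      exact (mul_eq_zero.1 a).elim b (nullWeight_pos c).ne'
    rw [Filter.eventually_false_iff_eq_bot, ae_eq_bot, Measure.restrict_eq_zero] at h2
    simp at h2
  set m₀ := ∫ y in Ioo (0 : ℝ) 1, w y with hm₀
  set m₁ := ∫ y in Ioo (0 : ℝ) 1, y * w y with hm₁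
  set m₂ := ∫ y in Ioo (0 : ℝ) 1, y ^ 2 * w y with hm₂
  set F₀ := ∫ y in Ioo (0 : ℝ) 1, f y with hF₀
  set F₁ := ∫ y in Ioo (0 : ℝ) 1, y * f y with hF₁
  have hm₀pos : 0 < m₀ := by
    have := hposint (fun _ => 1) (by simpa using hwi) (fun _ => zero_le_one) (ae_of_all _ (by simp))
    simpa using this
  -- Strict Cauchy–Schwarz: the integral of (m₀y - m₁)²w is m₀ times this determinant.
  have hdet : 0 < m₂ * m₀ - m₁ ^ 2 := by
    have e : ∀ y, (m₀ * y - m₁) ^ 2 * w y =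
        m₀ ^ 2 * (y ^ 2 * w y) - 2 * m₀ * m₁ * (y * w y) + m₁ ^ 2 * w y := fun y => by ring
    have hi : IntegrableOn (fun y => (m₀ * y - m₁) ^ 2 * w y) (Ioo 0 1) :=
      integrableOn_continuous_mul (by fun_prop) hwi
    have h := hposint (fun y => (m₀ * y - m₁) ^ 2) hi (fun _ => sq_nonneg _) (by
      have : ∀ᵐ y ∂(volume : Measure ℝ), y ≠ m₁ / m₀ := by simp [ae_iff]
      filter_upwards [this] with y hy h
      apply hy
      rw [eq_div_iff hm₀pos.ne']
      linarith [pow_eq_zero_iff two_ne_zero |>.1 h])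
    have hs : IntegrableOn (fun y => m₀ ^ 2 * (y ^ 2 * w y) - 2 * m₀ * m₁ * (y * w y)) (Ioo 0 1) :=
      (hyyw.const_mul _).sub (hyw.const_mul _)
    simp only [e] at h
    rw [integral_add hs (hwi.const_mul _),
      integral_sub (hyyw.const_mul _) (hyw.const_mul _), integral_const_mul, integral_const_mul,
      integral_const_mul, ← hm₀, ← hm₁, ← hm₂] at h
    by_contra hneg
    nlinarith
  -- Cramer's rule for cm₀ + dm₁ = F₀ and cm₁ + dm₂ = F₁.
  set d := (F₁ * m₀ - F₀ * m₁) / (m₂ * m₀ - m₁ ^ 2) with hd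
  set c := (F₀ * m₂ - F₁ * m₁) / (m₂ * m₀ - m₁ ^ 2) with hc
  have hgi : IntegrableOn (rieszNull 0 1 α (c + d) c) (Ioo 0 1) :=
    integrableOn_rieszNull zero_lt_one hα0 _ _
  have hg : ∀ y ∈ Ioo (0 : ℝ) 1, rieszNull 0 1 α (c + d) c y = c * w y + d * (y * w y) := by
    intro y hy
    rw [rieszNull_eq _ _ hy]; ring
  refine ⟨c + d, c, ?_⟩
  obtain ⟨C₁, hC₁⟩ := convOn_oddKernel_rieszNull zero_lt_one hα0 hα (c + d) c
  have key := ae_eq_zero_of_convOn_const hα0 hα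
    (f := fun y => f y + (-1) * rieszNull 0 1 α (c + d) c y) (hf.add (hgi.const_mul (-1)))
    (C₀ := C₀ + (-1) * C₁) ?_ ?_ ?_
  · filter_upwards [key] with x hx
    linarith
  · filter_upwards [hT, hC₁, convOn_add_ae (locallyIntegrable_oddKernel hα) hf
      (hgi.const_mul (-1))] with x h1 h2 h3
    rw [h3, convOn_const_mul, h1, h2]
  · rw [integral_add hf (hgi.const_mul _), integral_const_mul,
      setIntegral_congr_fun measurableSet_Ioo hg,
      integral_add (hwi.const_mul _) (hyw.const_mul _), integral_const_mul, integral_const_mul,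
      ← hF₀, ← hm₀, ← hm₁, hc, hd]
    field_simp
    ring
  · have e : ∀ y ∈ Ioo (0 : ℝ) 1, y * (f y + (-1) * rieszNull 0 1 α (c + d) c y) =
        y * f y - (c * (y * w y) + d * (y ^ 2 * w y)) := by
      intro y hy
      rw [hg y hy]; ring
    have hs : IntegrableOn (fun y => c * (y * w y) + d * (y ^ 2 * w y)) (Ioo 0 1) :=
      (hyw.const_mul _).add (hyyw.const_mul _)
    rw [setIntegral_congr_fun measurableSet_Ioo e, integral_sub hyf hs, integral_add (hyw.const_mul _)
      (hyyw.const_mul _), integral_const_mul, integral_const_mul, ← hF₁, ← hm₁, ← hm₂, hc, hd]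
    field_simp
    ring

/-- The integrable functions annihilated by the Riesz derivative are the Riesz null functions. -/
theorem ae_eq_rieszNull_of_integral_mul_rieszFracDeriv_eq_zero (hα0 : 0 < α) (hα : α < 1)
    (hf : IntegrableOn f (Ioo 0 1))
    (h : ∀ φ, IsTestFunction 0 1 φ → ∫ x in Ioo (0 : ℝ) 1, f x * rieszFracDeriv α φ x = 0) :
    ∃ c₁ c₂, f =ᵐ[volume.restrict (Ioo 0 1)] rieszNull 0 1 α c₁ c₂ := by
  obtain ⟨C₀, hC₀⟩ := ae_eq_const_of_integral_mul_deriv_eq_zero zero_lt_one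
    (integrableOn_convOn (locallyIntegrable_oddKernel hα) hf) fun φ hφ => by
      have h1 := h φ hφ
      rw [integral_mul_rieszFracDeriv hα hφ hf] at h1
      have h2 : 1 / (2 * Real.Gamma (1 - α)) ≠ 0 :=
        one_div_ne_zero (mul_ne_zero two_ne_zero (Real.Gamma_pos_of_pos (by linarith)).ne')
      exact (mul_eq_zero.1 h1).resolve_left (neg_ne_zero.2 h2)
  exact ae_eq_rieszNull_of_convOn_const hα0 hα hf hC₀

end Uniqueness

/-! ### Series with summable L¹ norms -/

section SummableSeries

variable {X : Type*} [MeasurableSpace X] {μ : Measure X} {F : ℕ → X → ℝ}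

theorem tsum_lintegral_enorm_ne_top (hF : ∀ n, Integrable (F n) μ)
    (hs : Summable fun n => ∫ x, ‖F n x‖ ∂μ) : ∫⁻ x, ∑' n, ‖F n x‖ₑ ∂μ ≠ ⊤ := by
  rw [lintegral_tsum fun n => (hF n).1.enorm]
  have h : ∀ n, ∫⁻ x, ‖F n x‖ₑ ∂μ = ENNReal.ofReal (∫ x, ‖F n x‖ ∂μ) := fun n =>
    (ofReal_integral_norm_eq_lintegral_enorm (hF n)).symm
  simp only [h]
  rw [← ENNReal.ofReal_tsum_of_nonneg (fun n => integral_nonneg fun x => norm_nonneg _) hs]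
  exact ENNReal.ofReal_ne_top

theorem ae_summable_of_summable_integral_norm (hF : ∀ n, Integrable (F n) μ)
    (hs : Summable fun n => ∫ x, ‖F n x‖ ∂μ) : ∀ᵐ x ∂μ, Summable fun n => F n x := by
  have h := ae_lt_top' (AEMeasurable.tsum fun n => (hF n).1.enorm)
    (tsum_lintegral_enorm_ne_top hF hs)
  filter_upwards [h] with x hx
  have := ENNReal.summable_toReal hx.ne
  simp only [toReal_enorm] at this
  exact this.of_norm

theorem integrable_tsum_of_summable_integral_norm (hF : ∀ n, Integrable (F n) μ)
    (hs : Summable fun n => ∫ x, ‖F n x‖ ∂μ) : Integrable (fun x => ∑' n, F n x) μ := by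
  have hae := ae_summable_of_summable_integral_norm hF hs
  refine ⟨aestronglyMeasurable_of_tendsto_ae atTop
    (f := fun N x => ∑ n ∈ Finset.range N, F n x)
    (fun N => Finset.aestronglyMeasurable_fun_sum _ fun n _ => (hF n).1) ?_, ?_⟩
  · filter_upwards [hae] with x hx using hx.hasSum.tendsto_sum_nat
  · refine lt_of_le_of_lt (lintegral_mono fun x => ?_)
      (tsum_lintegral_enorm_ne_top hF hs).lt_top
    exact enorm_tsum_le_tsum_enorm

end SummableSeries

/-! ### Convergence of Jacobi series -/

section JacobiSeries

open Polynomial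

variable {α : ℝ} {c : ℕ → ℝ}

/-- The squared norm of `jacobiG α n` in the weighted space. -/
def jacobiNormSq (α : ℝ) (n : ℕ) : ℝ :=
  ∫ x in Ioo (0 : ℝ) 1, jacobiWeight α x * jacobiG α n x ^ 2

theorem continuous_jacobiG (α : ℝ) (n : ℕ) : Continuous (jacobiG α n) := by
  rw [← funext (eval_jacobiPoly α n)]
  exact (jacobiPoly α n).continuous

theorem jacobiNormSq_pos (hα0 : 0 < α) (n : ℕ) : 0 < jacobiNormSq α n := by
  have := integral_jacobiWeight_mul_sq_pos hα0 (jacobiPoly_ne_zero hα0 n)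
  simp only [eval_jacobiPoly] at this
  exact this

/-- Cauchy–Schwarz up to a constant, from |G| ≤ s/2 + G²/(2s) with s the weighted norm of G_n. Only
a bound linear in s matters. -/
theorem integral_abs_jacobiWeight_mul_jacobiG_le (hα0 : 0 < α) (n : ℕ) :
    ∫ x in Ioo (0 : ℝ) 1, ‖jacobiWeight α x * jacobiG α n x‖ ≤
      ((∫ x in Ioo (0 : ℝ) 1, jacobiWeight α x) + 1) / 2 * √(jacobiNormSq α n) := by
  set s := √(jacobiNormSq α n) with hs
  have hs0 : 0 < s := Real.sqrt_pos.2 (jacobiNormSq_pos hα0 n)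
  have hss : s * s = jacobiNormSq α n := Real.mul_self_sqrt (jacobiNormSq_pos hα0 n).le
  have hG := continuous_jacobiG α n
  have hi1 : IntegrableOn (fun x => jacobiWeight α x * jacobiG α n x) (Ioo 0 1) :=
    integrableOn_jacobiWeight_mul hα0 hG
  have hi2 : IntegrableOn (fun x => jacobiWeight α x) (Ioo 0 1) := by
    simpa using integrableOn_jacobiWeight_mul hα0 (continuous_const (y := (1 : ℝ)))
  have hi3 : IntegrableOn (fun x => jacobiWeight α x * jacobiG α n x ^ 2) (Ioo 0 1) :=
    integrableOn_jacobiWeight_mul hα0 (hG.pow 2)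
  calc ∫ x in Ioo (0 : ℝ) 1, ‖jacobiWeight α x * jacobiG α n x‖
      ≤ ∫ x in Ioo (0 : ℝ) 1, (s / 2 * jacobiWeight α x +
          1 / (2 * s) * (jacobiWeight α x * jacobiG α n x ^ 2)) := by
        refine setIntegral_mono_on hi1.norm ((hi2.const_mul _).add (hi3.const_mul _))
          measurableSet_Ioo fun x hx => ?_
        have hw := jacobiWeight_pos (α := α) hx
        rw [norm_mul, Real.norm_of_nonneg hw.le, Real.norm_eq_abs]
        have h1 : |jacobiG α n x| ≤ s / 2 + 1 / (2 * s) * jacobiG α n x ^ 2 := by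
          have h2 : 0 ≤ (s - |jacobiG α n x|) ^ 2 / (2 * s) := by positivity
          have h3 : (s - |jacobiG α n x|) ^ 2 / (2 * s) =
              s / 2 + 1 / (2 * s) * |jacobiG α n x| ^ 2 - |jacobiG α n x| := by
            field_simp; ring
          rw [h3, sq_abs] at h2
          linarith
        calc jacobiWeight α x * |jacobiG α n x|
            ≤ jacobiWeight α x * (s / 2 + 1 / (2 * s) * jacobiG α n x ^ 2) :=
              mul_le_mul_of_nonneg_left h1 hw.le
          _ = _ := by ring
    _ = _ := by
        rw [integral_add (hi2.const_mul _) (hi3.const_mul _), integral_const_mul,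
          integral_const_mul]
        change _ + 1 / (2 * s) * jacobiNormSq α n = _
        rw [← hss]
        field_simp

theorem integrableOn_jacobiTerm (hα0 : 0 < α) (c : ℕ → ℝ) (n : ℕ) :
    IntegrableOn (fun x => jacobiWeight α x * (c n * jacobiG α n x)) (Ioo 0 1) :=
  integrableOn_jacobiWeight_mul hα0 (continuous_const.mul (continuous_jacobiG α n))

theorem summable_integral_norm_jacobiTerm (hα0 : 0 < α)
    (hc : Summable fun n => |c n| * √(jacobiNormSq α n)) :
    Summable fun n => ∫ x in Ioo (0 : ℝ) 1, ‖jacobiWeight α x * (c n * jacobiG α n x)‖ := by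
  refine Summable.of_nonneg_of_le (fun n => integral_nonneg fun x => norm_nonneg _) (fun n => ?_)
    (hc.mul_left (((∫ x in Ioo (0 : ℝ) 1, jacobiWeight α x) + 1) / 2))
  have e : ∀ x, ‖jacobiWeight α x * (c n * jacobiG α n x)‖ =
      |c n| * ‖jacobiWeight α x * jacobiG α n x‖ := fun x => by
    rw [← Real.norm_eq_abs, ← norm_mul]; congr 1; ring
  simp only [e]
  rw [integral_const_mul]
  calc |c n| * ∫ x in Ioo (0 : ℝ) 1, ‖jacobiWeight α x * jacobiG α n x‖
      ≤ |c n| * (((∫ x in Ioo (0 : ℝ) 1, jacobiWeight α x) + 1) / 2 * √(jacobiNormSq α n)) :=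
        mul_le_mul_of_nonneg_left (integral_abs_jacobiWeight_mul_jacobiG_le hα0 n) (abs_nonneg _)
    _ = _ := by ring

theorem ae_summable_jacobiSeries (hα0 : 0 < α)
    (hc : Summable fun n => |c n| * √(jacobiNormSq α n)) :
    ∀ᵐ x ∂(volume.restrict (Ioo (0 : ℝ) 1)), Summable fun n => c n * jacobiG α n x := by
  filter_upwards [ae_summable_of_summable_integral_norm (integrableOn_jacobiTerm hα0 c)
    (summable_integral_norm_jacobiTerm hα0 hc), ae_restrict_mem measurableSet_Ioo] with x h hx
  exact (summable_mul_left_iff (jacobiWeight_pos hx).ne').1 h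

theorem integrableOn_jacobiSeries (hα0 : 0 < α)
    (hc : Summable fun n => |c n| * √(jacobiNormSq α n)) :
    IntegrableOn (fun x => jacobiWeight α x * ∑' n, c n * jacobiG α n x) (Ioo 0 1) := by
  have h := integrable_tsum_of_summable_integral_norm (integrableOn_jacobiTerm hα0 c)
    (summable_integral_norm_jacobiTerm hα0 hc)
  simp only [tsum_mul_left] at h
  exact h

/-- Termwise integration against a bounded ψ, needed for ψ the Riesz derivative of a test function.
-/
theorem hasSum_integral_jacobiSeries_mul (hα0 : 0 < α)
    (hc : Summable fun n => |c n| * √(jacobiNormSq α n)) {ψ : ℝ → ℝ} {M : ℝ}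
    (hψ : Continuous ψ) (hM : ∀ x ∈ Ioo (0 : ℝ) 1, |ψ x| ≤ M) :
    HasSum (fun n => c n * ∫ x in Ioo (0 : ℝ) 1, jacobiWeight α x * jacobiG α n x * ψ x)
      (∫ x in Ioo (0 : ℝ) 1, (jacobiWeight α x * ∑' n, c n * jacobiG α n x) * ψ x) := by
  have hi : ∀ n, IntegrableOn (fun x => jacobiWeight α x * (c n * jacobiG α n x) * ψ x)
      (Ioo 0 1) := fun n => integrableOn_jacobiWeight_mul_mul hα0
        (continuous_const.mul (continuous_jacobiG α n)) hψ
  have h := hasSum_integral_of_summable_integral_norm hi ?_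
  · have e1 : (fun n => c n * ∫ x in Ioo (0 : ℝ) 1, jacobiWeight α x * jacobiG α n x * ψ x) =
        fun n => ∫ x in Ioo (0 : ℝ) 1, jacobiWeight α x * (c n * jacobiG α n x) * ψ x := by
      funext n
      rw [← integral_const_mul]
      congr 1; funext x; ring
    simp only [tsum_mul_right, tsum_mul_left] at h
    rw [e1]
    exact h
  · refine Summable.of_nonneg_of_le (fun n => integral_nonneg fun x => norm_nonneg _)
      (fun n => ?_) ((summable_integral_norm_jacobiTerm hα0 hc).mul_right M)
    rw [← integral_mul_const]
    refine setIntegral_mono_on (hi n).norm ((integrableOn_jacobiTerm hα0 c n).norm.mul_const M)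
      measurableSet_Ioo fun x hx => ?_
    rw [norm_mul _ (ψ x)]
    exact mul_le_mul_of_nonneg_left (hM x hx) (norm_nonneg _)

theorem integral_jacobiWeight_mul_sum_sq (hα0 : 0 < α) (c : ℕ → ℝ) (s : Finset ℕ) :
    ∫ x in Ioo (0 : ℝ) 1, jacobiWeight α x * (∑ n ∈ s, c n * jacobiG α n x) ^ 2 =
      ∑ n ∈ s, c n ^ 2 * jacobiNormSq α n := by
  have e : ∀ x, jacobiWeight α x * (∑ n ∈ s, c n * jacobiG α n x) ^ 2 =
      ∑ n ∈ s, ∑ m ∈ s, c n * c m * (jacobiWeight α x * jacobiG α n x * jacobiG α m x) := by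
    intro x
    rw [sq, Finset.sum_mul_sum, Finset.mul_sum]
    refine Finset.sum_congr rfl fun n _ => ?_
    rw [Finset.mul_sum]
    exact Finset.sum_congr rfl fun m _ => by ring
  have hi : ∀ n m, IntegrableOn
      (fun x => c n * c m * (jacobiWeight α x * jacobiG α n x * jacobiG α m x)) (Ioo 0 1) :=
    fun n m => (integrableOn_jacobiWeight_mul_mul hα0 (continuous_jacobiG α n)
      (continuous_jacobiG α m)).const_mul _
  simp only [e]
  rw [integral_finsetSum _ fun n _ => integrable_finsetSum _ fun m _ => hi n m]
  refine Finset.sum_congr rfl fun n hn => ?_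
  rw [integral_finsetSum _ fun m _ => hi n m, Finset.sum_eq_single n]
  · rw [integral_const_mul, jacobiNormSq, sq]
    congr 2; funext x; ring
  · intro m _ hm
    rw [integral_const_mul, integral_jacobiWeight_mul_jacobiG_mul_jacobiG hα0 hm.symm, mul_zero]
  · exact fun h => absurd hn h

/-- By orthogonality the squared distance between two partial sums is a block of ∑c_n²‖G_n‖²;
Fatou's lemma passes to the pointwise limit and leaves the tail of this series. -/
theorem tendsto_lintegral_jacobiSeries (hα0 : 0 < α)
    (hc : Summable fun n => |c n| * √(jacobiNormSq α n)) :
    Tendsto (fun N : ℕ => ∫⁻ x in Ioo (0 : ℝ) 1, ENNReal.ofReal (jacobiWeight α x *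
      ((∑ n ∈ Finset.range N, c n * jacobiG α n x) - ∑' n, c n * jacobiG α n x) ^ 2))
      atTop (𝓝 0) := by
  set T : ℕ → ℝ := fun n => c n ^ 2 * jacobiNormSq α n with hT
  have hT0 : ∀ n, 0 ≤ T n := fun n => mul_nonneg (sq_nonneg _) (jacobiNormSq_pos hα0 n).le
  have hTs : Summable T := by
    -- A summable nonnegative sequence has summable squares, each term being at most the total sum.
    refine Summable.of_nonneg_of_le hT0 (fun n => ?_)
      (hc.mul_left (∑' n, |c n| * √(jacobiNormSq α n)))
    have h0 : 0 ≤ |c n| * √(jacobiNormSq α n) := by positivity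
    have h1 := hc.le_tsum n fun m _ => (by positivity : 0 ≤ |c m| * √(jacobiNormSq α m))
    calc T n = (|c n| * √(jacobiNormSq α n)) * (|c n| * √(jacobiNormSq α n)) := by
          rw [mul_mul_mul_comm, abs_mul_abs_self, Real.mul_self_sqrt (jacobiNormSq_pos hα0 n).le,
            ← sq]
      _ ≤ _ := mul_le_mul_of_nonneg_right h1 h0
  have hbound : ∀ N, ∫⁻ x in Ioo (0 : ℝ) 1, ENNReal.ofReal (jacobiWeight α x *
      ((∑ n ∈ Finset.range N, c n * jacobiG α n x) - ∑' n, c n * jacobiG α n x) ^ 2) ≤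
      ENNReal.ofReal (∑' k, T (k + N)) := by
    intro N
    set f : ℕ → ℝ → ENNReal := fun M x => ENNReal.ofReal (jacobiWeight α x *
      ((∑ n ∈ Finset.range N, c n * jacobiG α n x) - ∑ n ∈ Finset.range M, c n * jacobiG α n x) ^ 2)
      with hf
    have hcont : ∀ M, Continuous fun x => jacobiWeight α x *
      ((∑ n ∈ Finset.range N, c n * jacobiG α n x) -
        ∑ n ∈ Finset.range M, c n * jacobiG α n x) ^ 2 := by
      intro M
      have h1 : ∀ K : ℕ, Continuous fun x => ∑ n ∈ Finset.range K, c n * jacobiG α n x := fun K =>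
        continuous_finsetSum _ fun n _ => continuous_const.mul (continuous_jacobiG α n)
      exact (continuous_jacobiWeight hα0).mul (((h1 N).sub (h1 M)).pow 2)
    have hle : ∀ M, N ≤ M → ∫⁻ x in Ioo (0 : ℝ) 1, f M x ≤ ENNReal.ofReal (∑' k, T (k + N)) := by
      intro M hNM
      rw [hf, ← ofReal_integral_eq_lintegral_ofReal
        (((hcont M).continuousOn.integrableOn_compact isCompact_Icc).mono_set Ioo_subset_Icc_self)]
      · refine ENNReal.ofReal_le_ofReal ?_
        have e : ∀ x, jacobiWeight α x * ((∑ n ∈ Finset.range N, c n * jacobiG α n x) -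
            ∑ n ∈ Finset.range M, c n * jacobiG α n x) ^ 2 =
            jacobiWeight α x * (∑ n ∈ Finset.Ico N M, c n * jacobiG α n x) ^ 2 := by
          intro x
          rw [Finset.sum_Ico_eq_sub _ hNM]; ring
        simp only [e]
        rw [integral_jacobiWeight_mul_sum_sq hα0, Finset.sum_Ico_eq_sum_range]
        have hs : Summable fun k => T (k + N) := (summable_nat_add_iff N).2 hTs
        have := hs.sum_le_tsum (Finset.range (M - N)) fun k _ => hT0 (k + N)
        refine le_trans (le_of_eq ?_) this
        exact Finset.sum_congr rfl fun k _ => by rw [add_comm]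
      · filter_upwards [ae_restrict_mem measurableSet_Ioo] with x hx
        exact mul_nonneg (jacobiWeight_pos hx).le (sq_nonneg _)
    calc _ = ∫⁻ x in Ioo (0 : ℝ) 1, liminf (fun M => f M x) atTop := by
          refine lintegral_congr_ae ?_
          filter_upwards [ae_summable_jacobiSeries hα0 hc] with x hx
          refine (Tendsto.liminf_eq ?_).symm
          exact ENNReal.tendsto_ofReal
            (((tendsto_const_nhds.sub hx.hasSum.tendsto_sum_nat).pow 2).const_mul _)
      _ ≤ liminf (fun M => ∫⁻ x in Ioo (0 : ℝ) 1, f M x) atTop :=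
          lintegral_liminf_le fun M => (hcont M).measurable.ennreal_ofReal
      _ ≤ _ := by
          refine liminf_le_of_frequently_le' (Eventually.frequently ?_)
          filter_upwards [eventually_ge_atTop N] with M hM using hle M hM
  refine tendsto_of_tendsto_of_tendsto_of_le_of_le tendsto_const_nhds ?_ (fun _ => zero_le)
    hbound
  have := ENNReal.tendsto_ofReal (tendsto_sum_nat_add T)
  rwa [ENNReal.ofReal_zero] at this

end JacobiSeries

/-! ### Decay of the inverse eigenvalues -/

section GammaRatio

variable {α : ℝ}

/-- Log-convexity of Γ at x + 1 = α(x + α) + (1 - α)(x + α + 1). -/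
theorem Gamma_div_Gamma_le (hα0 : 0 < α) (hα : α < 1) {x : ℝ} (hx : 0 < x) :
    Real.Gamma (x + 1) / Real.Gamma (x + 1 + α) ≤ x ^ (-α) := by
  have hxα : 0 < x + α := by linarith
  have hG : 0 < Real.Gamma (x + α) := Real.Gamma_pos_of_pos hxα
  have h := Real.Gamma_mul_add_mul_le_rpow_Gamma_mul_rpow_Gamma (s := x + α) (t := x + α + 1)
    hxα (by linarith) hα0 (by linarith : 0 < 1 - α) (by ring)
  rw [show α * (x + α) + (1 - α) * (x + α + 1) = x + 1 by ring, Real.Gamma_add_one hxα.ne',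
    Real.mul_rpow hxα.le hG.le] at h
  rw [show x + 1 + α = x + α + 1 by ring, Real.Gamma_add_one hxα.ne',
    div_le_iff₀ (mul_pos hxα hG)]
  calc Real.Gamma (x + 1)
      ≤ Real.Gamma (x + α) ^ α * ((x + α) ^ (1 - α) * Real.Gamma (x + α) ^ (1 - α)) := h
    _ = (x + α) ^ (-α) * ((x + α) * Real.Gamma (x + α)) := by
        rw [mul_left_comm, ← Real.rpow_add hG, show α + (1 - α) = 1 by ring, Real.rpow_one,
          show 1 - α = -α + 1 by ring, Real.rpow_add_one hxα.ne']
        ring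
    _ ≤ x ^ (-α) * ((x + α) * Real.Gamma (x + α)) := by
        refine mul_le_mul_of_nonneg_right ?_ (mul_pos hxα hG).le
        exact Real.rpow_le_rpow_of_nonpos hx (by linarith) (by linarith)

theorem summable_Gamma_div_Gamma_sq (hα0 : 1 / 2 < α) (hα : α < 1) :
    Summable fun n : ℕ => (Real.Gamma (n + 1) / Real.Gamma (n + 1 + α)) ^ 2 := by
  -- The bound n^(-α) needs n > 0, so the term n = 0 is dropped.
  rw [← summable_nat_add_iff 1]
  have hs : Summable fun n : ℕ => ((n + 1 : ℕ) : ℝ) ^ (-(2 * α)) :=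
    (summable_nat_add_iff (f := fun n : ℕ => (n : ℝ) ^ (-(2 * α))) 1).2
      (Real.summable_nat_rpow.2 (by linarith))
  refine Summable.of_nonneg_of_le (fun n => sq_nonneg _) (fun n => ?_) hs
  have hn : (0 : ℝ) < ((n + 1 : ℕ) : ℝ) := by positivity
  have h := Gamma_div_Gamma_le (by linarith) hα hn
  have h0 : 0 ≤ Real.Gamma (((n + 1 : ℕ) : ℝ) + 1) / Real.Gamma (((n + 1 : ℕ) : ℝ) + 1 + α) :=
    div_nonneg (Real.Gamma_pos_of_pos (by positivity)).le (Real.Gamma_pos_of_pos (by positivity)).le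
  calc _ ≤ (((n + 1 : ℕ) : ℝ) ^ (-α)) ^ 2 := pow_le_pow_left₀ h0 h 2
    _ = _ := by rw [← Real.rpow_natCast, ← Real.rpow_mul hn.le]; congr 1; push_cast; ring

end GammaRatio

/-! ### Completeness: multiplication by √ρ carries L²(ρ) into L²(0, 1) -/

section HilbertBasis

open Polynomial

variable {α : ℝ}

theorem inner_toLp_toLp {μ : Measure ℝ} {F G : ℝ → ℝ} (hF : MemLp F 2 μ) (hG : MemLp G 2 μ) :
    inner ℝ (hF.toLp F) (hG.toLp G) = ∫ x, F x * G x ∂μ := by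
  rw [L2.inner_def]
  refine integral_congr_ae ?_
  filter_upwards [hF.coeFn_toLp, hG.coeFn_toLp] with x h1 h2
  rw [h1, h2]
  simp [mul_comm]

/-- The orthonormal Jacobi functions. -/
def jacobiUnit (α : ℝ) (n : ℕ) (x : ℝ) : ℝ :=
  √(jacobiWeight α x) * (jacobiG α n x / √(jacobiNormSq α n))

theorem continuous_sqrt_jacobiWeight (hα0 : 0 < α) : Continuous fun x => √(jacobiWeight α x) :=
  (continuous_jacobiWeight hα0).sqrt

theorem memLp_jacobiUnit (hα0 : 0 < α) (n : ℕ) :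
    MemLp (jacobiUnit α n) 2 (volume.restrict (Ioo 0 1)) := by
  have hc : Continuous (jacobiUnit α n) :=
    (continuous_sqrt_jacobiWeight hα0).mul ((continuous_jacobiG α n).div_const _)
  rw [memLp_two_iff_integrable_sq hc.aestronglyMeasurable]
  exact ((hc.pow 2).continuousOn.integrableOn_compact isCompact_Icc).mono_set Ioo_subset_Icc_self

theorem integral_jacobiUnit_mul_jacobiUnit (n m : ℕ) :
    ∫ x in Ioo (0 : ℝ) 1, jacobiUnit α n x * jacobiUnit α m x =
      1 / (√(jacobiNormSq α n) * √(jacobiNormSq α m)) *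
        ∫ x in Ioo (0 : ℝ) 1, jacobiWeight α x * jacobiG α n x * jacobiG α m x := by
  rw [← integral_const_mul]
  refine setIntegral_congr_fun measurableSet_Ioo fun x hx => ?_
  have h := Real.mul_self_sqrt (jacobiWeight_pos (α := α) hx).le
  simp only [jacobiUnit]
  rw [mul_mul_mul_comm, h]
  ring

theorem orthonormal_jacobiUnit (hα0 : 0 < α) :
    Orthonormal ℝ fun n => (memLp_jacobiUnit hα0 n).toLp (jacobiUnit α n) := by
  rw [orthonormal_iff_ite]
  intro n m
  rw [inner_toLp_toLp, integral_jacobiUnit_mul_jacobiUnit]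
  split_ifs with h
  · subst h
    have h1 : ∫ x in Ioo (0 : ℝ) 1, jacobiWeight α x * jacobiG α n x * jacobiG α n x =
        jacobiNormSq α n := by
      rw [jacobiNormSq]; congr 1; funext x; ring
    rw [h1, Real.mul_self_sqrt (jacobiNormSq_pos hα0 n).le,
      one_div_mul_cancel (jacobiNormSq_pos hα0 n).ne']
  · rw [integral_jacobiWeight_mul_jacobiG_mul_jacobiG hα0 h, mul_zero]

/-- Each G_n has exact degree n, so the moments vanish one after another. -/
theorem ae_eq_zero_of_integral_jacobiG_eq_zero (hα0 : 0 < α) {f : ℝ → ℝ}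
    (hf : IntegrableOn f (Ioo 0 1))
    (h : ∀ n, ∫ x in Ioo (0 : ℝ) 1, jacobiG α n x * f x = 0) :
    f =ᵐ[volume.restrict (Ioo 0 1)] fun _ => 0 := by
  refine ae_eq_zero_of_moments_eq_zero hf fun n => ?_
  induction n using Nat.strong_induction_on with
  | _ n ih =>
    have h2 := h n
    simp only [jacobiG, Finset.sum_mul, mul_assoc] at h2
    rw [integral_finsetSum _ fun i _ =>
      (integrableOn_continuous_mul (by fun_prop) hf).const_mul _, Finset.sum_range_succ,
      Finset.sum_eq_zero, zero_add, integral_const_mul] at h2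
    · exact (mul_eq_zero.1 h2).resolve_left (jacobiCoeff_self_ne_zero hα0 n)
    · intro i hi
      rw [integral_const_mul, ih i (by simpa using hi), mul_zero]

theorem orthogonal_span_jacobiUnit (hα0 : 0 < α) :
    (Submodule.span ℝ (range fun n =>
      (memLp_jacobiUnit hα0 n).toLp (jacobiUnit α n)))ᗮ = ⊥ := by
  rw [eq_bot_iff]
  intro F hF
  rw [Submodule.mem_bot]
  have hFm : MemLp F 2 (volume.restrict (Ioo (0 : ℝ) 1)) := Lp.memLp F
  have hFi : IntegrableOn F (Ioo (0 : ℝ) 1) := hFm.integrable one_le_two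
  have hfi : IntegrableOn (fun x => √(jacobiWeight α x) * F x) (Ioo (0 : ℝ) 1) :=
    integrableOn_continuous_mul (continuous_sqrt_jacobiWeight hα0) hFi
  have h0 : ∀ n, ∫ x in Ioo (0 : ℝ) 1, jacobiG α n x * (√(jacobiWeight α x) * F x) = 0 := by
    intro n
    have h1 : inner ℝ ((memLp_jacobiUnit hα0 n).toLp (jacobiUnit α n)) (hFm.toLp F) = 0 := by
      rw [Lp.toLp_coeFn]
      exact (Submodule.mem_orthogonal _ _).1 hF _ (Submodule.subset_span ⟨n, rfl⟩)
    rw [inner_toLp_toLp] at h1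
    have h2 : ∀ x, jacobiUnit α n x * F x =
        1 / √(jacobiNormSq α n) * (jacobiG α n x * (√(jacobiWeight α x) * F x)) := fun x => by
      rw [jacobiUnit]; ring
    simp only [h2] at h1
    rw [integral_const_mul] at h1
    exact (mul_eq_zero.1 h1).resolve_left
      (one_div_ne_zero (Real.sqrt_pos.2 (jacobiNormSq_pos hα0 n)).ne')
  rw [Lp.eq_zero_iff_ae_eq_zero]
  filter_upwards [ae_eq_zero_of_integral_jacobiG_eq_zero hα0 hfi h0,
    ae_restrict_mem measurableSet_Ioo] with x hx hm
  exact (mul_eq_zero.1 hx).resolve_left (Real.sqrt_pos.2 (jacobiWeight_pos hm)).ne'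

/-- Parseval's identity for the Jacobi functions. -/
theorem hasSum_integral_jacobiUnit (hα0 : 0 < α) {F G : ℝ → ℝ}
    (hF : MemLp F 2 (volume.restrict (Ioo 0 1))) (hG : MemLp G 2 (volume.restrict (Ioo 0 1))) :
    HasSum (fun n => (∫ x in Ioo (0 : ℝ) 1, F x * jacobiUnit α n x) *
      ∫ x in Ioo (0 : ℝ) 1, jacobiUnit α n x * G x) (∫ x in Ioo (0 : ℝ) 1, F x * G x) := by
  have h := (HilbertBasis.mkOfOrthogonalEqBot (orthonormal_jacobiUnit hα0)
    (orthogonal_span_jacobiUnit hα0)).hasSum_inner_mul_inner (hF.toLp F) (hG.toLp G)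
  simp only [HilbertBasis.coe_mkOfOrthogonalEqBot, inner_toLp_toLp] at h
  exact h

end HilbertBasis

/-! ### The series solution and part (ii) -/

section Representation

variable {α : ℝ}

/-- The squared function is a polynomial times (x(1 - x))^(3α/2 - 2), and 3α/2 - 2 > -1 is the
condition α > 2/3. -/
theorem memLp_sqrt_jacobiWeight_mul_rieszNull (hα : 2 / 3 < α) (c₁ c₂ : ℝ) :
    MemLp (fun x => √(jacobiWeight α x) * rieszNull 0 1 α c₁ c₂ x) 2
      (volume.restrict (Ioo 0 1)) := by
  have hα0 : 0 < α := by linarith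
  refine (memLp_two_iff_integrable_sq (f := fun x => √(jacobiWeight α x) * rieszNull 0 1 α c₁ c₂ x)
    ((continuous_sqrt_jacobiWeight hα0).aestronglyMeasurable.mul
      (integrableOn_rieszNull zero_lt_one hα0 c₁ c₂).aestronglyMeasurable)).2 ?_
  have h := integrableOn_continuous_mul (g := fun x => (c₁ * x + c₂ * (1 - x)) ^ 2) (by fun_prop)
    (integrableOn_rpow_mul_rpow zero_lt_one (by linarith : -1 < 3 * α / 2 - 2)
      (by linarith : -1 < 3 * α / 2 - 2))
  refine IntegrableOn.congr_fun h (fun x hx => ?_) measurableSet_Ioo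
  have h1 : ∀ y : ℝ, 0 < y → y ^ (3 * α / 2 - 2) = y ^ (α / 2) * (y ^ (α / 2 - 1)) ^ 2 := by
    intro y hy
    rw [← Real.rpow_natCast, ← Real.rpow_mul hy.le, ← Real.rpow_add hy]
    congr 1; push_cast; ring
  rw [rieszNull_eq c₁ c₂ hx, mul_pow, Real.sq_sqrt (jacobiWeight_pos hx).le, nullWeight,
    jacobiWeight, sub_zero, h1 x hx.1, h1 (1 - x) (by linarith [hx.2])]
  ring

/-- The support of φ avoids the zeros of ρ, so the quotient is continuous. It is the partner of √ρ κ
in Parseval's identity. -/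
theorem memLp_div_sqrt_jacobiWeight (hα0 : 0 < α) {φ : ℝ → ℝ} (hφ : IsTestFunction 0 1 φ) :
    MemLp (fun x => φ x / √(jacobiWeight α x)) 2 (volume.restrict (Ioo 0 1)) := by
  have hc : Continuous fun x => φ x / √(jacobiWeight α x) := by
    refine continuous_of_tsupport fun x hx => ?_
    have hx' : x ∈ tsupport φ := by
      have hsub : (Function.support fun x => φ x / √(jacobiWeight α x)) ⊆ Function.support φ :=
        fun y hy h => hy (by simp only [h, zero_div])
      exact closure_mono hsub hx
    exact hφ.smooth.continuous.continuousAt.div (continuous_sqrt_jacobiWeight hα0).continuousAt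
      (Real.sqrt_pos.2 (jacobiWeight_pos (hφ.support_subset hx'))).ne'
  rw [memLp_two_iff_integrable_sq hc.aestronglyMeasurable]
  exact ((hc.pow 2).continuousOn.integrableOn_compact isCompact_Icc).mono_set Ioo_subset_Icc_self

theorem integral_rieszNull_mul_jacobiUnit (c₁ c₂ : ℝ) (n : ℕ) :
    ∫ x in Ioo (0 : ℝ) 1, √(jacobiWeight α x) * rieszNull 0 1 α c₁ c₂ x * jacobiUnit α n x =
      (∫ x in Ioo (0 : ℝ) 1, jacobiWeight α x * rieszNull 0 1 α c₁ c₂ x * jacobiG α n x) /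
        √(jacobiNormSq α n) := by
  rw [← integral_div]
  refine setIntegral_congr_fun measurableSet_Ioo fun x hx => ?_
  have h := Real.mul_self_sqrt (jacobiWeight_pos (α := α) hx).le
  simp only [jacobiUnit]
  nth_rewrite 3 [← h]
  ring

theorem integral_jacobiUnit_mul_div (n : ℕ) (φ : ℝ → ℝ) :
    ∫ x in Ioo (0 : ℝ) 1, jacobiUnit α n x * (φ x / √(jacobiWeight α x)) =
      (∫ x in Ioo (0 : ℝ) 1, jacobiG α n x * φ x) / √(jacobiNormSq α n) := by
  rw [← integral_div]
  refine setIntegral_congr_fun measurableSet_Ioo fun x hx => ?_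
  have h := (Real.sqrt_pos.2 (jacobiWeight_pos (α := α) hx)).ne'
  simp only [jacobiUnit]
  field_simp

theorem seriesCoeff_eq (c₁ c₂ : ℝ) (n : ℕ) :
    seriesCoeff α (rieszNull 0 1 α c₁ c₂) n = -(Real.Gamma (n + 1) / Real.Gamma (n + 1 + α)) *
      ((∫ x in Ioo (0 : ℝ) 1, √(jacobiWeight α x) * rieszNull 0 1 α c₁ c₂ x * jacobiUnit α n x) /
        √(jacobiNormSq α n)) := by
  rw [integral_rieszNull_mul_jacobiUnit, div_div, ← sq, Real.sq_sqrt, seriesCoeff, jacobiNormSq]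
  exact setIntegral_nonneg measurableSet_Ioo fun x hx =>
    mul_nonneg (jacobiWeight_pos hx).le (sq_nonneg _)

/-- Each term is R|A|, with R the inverse Gamma ratio and A a Fourier coefficient of √ρ κ. Both are
square summable, by α > 1/2 and by Parseval, and R|A| ≤ R² + A². -/
theorem summable_abs_seriesCoeff (hα : 2 / 3 < α) (hα1 : α < 1) (c₁ c₂ : ℝ) :
    Summable fun n => |seriesCoeff α (rieszNull 0 1 α c₁ c₂) n| * √(jacobiNormSq α n) := by
  have hα0 : 0 < α := by linarith
  have hF := memLp_sqrt_jacobiWeight_mul_rieszNull hα c₁ c₂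
  have h1 := summable_Gamma_div_Gamma_sq (by linarith) hα1
  have h2 := (hasSum_integral_jacobiUnit hα0 hF hF).summable
  refine Summable.of_nonneg_of_le (fun n => by positivity) (fun n => ?_) (h1.add h2)
  rw [seriesCoeff_eq]
  have hs : 0 < √(jacobiNormSq α n) := Real.sqrt_pos.2 (jacobiNormSq_pos hα0 n)
  have hR : 0 ≤ Real.Gamma (n + 1) / Real.Gamma (n + 1 + α) :=
    div_nonneg (Real.Gamma_pos_of_pos (by positivity)).le (Real.Gamma_pos_of_pos (by positivity)).le
  have e : ∫ x in Ioo (0 : ℝ) 1, jacobiUnit α n x *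
      (√(jacobiWeight α x) * rieszNull 0 1 α c₁ c₂ x) =
      ∫ x in Ioo (0 : ℝ) 1, √(jacobiWeight α x) * rieszNull 0 1 α c₁ c₂ x * jacobiUnit α n x := by
    congr 1; funext x; ring
  rw [e]
  generalize ∫ x in Ioo (0 : ℝ) 1,
    √(jacobiWeight α x) * rieszNull 0 1 α c₁ c₂ x * jacobiUnit α n x = A
  generalize Real.Gamma (n + 1) / Real.Gamma (n + 1 + α) = R at hR
  rw [abs_mul, abs_neg, abs_of_nonneg hR, abs_div, abs_of_pos hs, mul_assoc,
    div_mul_cancel₀ _ hs.ne', ← abs_mul_abs_self A]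
  nlinarith [sq_nonneg (R - |A|), sq_nonneg R, abs_nonneg A, mul_self_nonneg |A|]

/-- The Riesz derivative of the Jacobi series that belongs to a null function `κ` is a multiple of
`κ`. -/
theorem integral_jacobiSeries_mul_rieszFracDeriv (hα : 2 / 3 < α) (hα1 : α < 1) (c₁ c₂ : ℝ)
    {φ : ℝ → ℝ} (hφ : IsTestFunction 0 1 φ) :
    ∫ x in Ioo (0 : ℝ) 1, (jacobiWeight α x * ∑' n, seriesCoeff α (rieszNull 0 1 α c₁ c₂) n *
      jacobiG α n x) * rieszFracDeriv α φ x =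
      -(1 / (2 * Real.Gamma (1 - α)) * potentialConst α) *
        ∫ x in Ioo (0 : ℝ) 1, rieszNull 0 1 α c₁ c₂ x * φ x := by
  have hα0 : 0 < α := by linarith
  obtain ⟨M, hM⟩ := rieszFracDeriv_bounded hα1 hφ
  have h1 := hasSum_integral_jacobiSeries_mul hα0 (summable_abs_seriesCoeff hα hα1 c₁ c₂)
    (continuous_rieszFracDeriv hα1 hφ) hM
  have h2 := (hasSum_integral_jacobiUnit hα0 (memLp_sqrt_jacobiWeight_mul_rieszNull hα c₁ c₂)
    (memLp_div_sqrt_jacobiWeight hα0 hφ)).mul_left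
      (-(1 / (2 * Real.Gamma (1 - α)) * potentialConst α))
  have h3 : ∫ x in Ioo (0 : ℝ) 1, √(jacobiWeight α x) * rieszNull 0 1 α c₁ c₂ x *
      (φ x / √(jacobiWeight α x)) = ∫ x in Ioo (0 : ℝ) 1, rieszNull 0 1 α c₁ c₂ x * φ x := by
    refine setIntegral_congr_fun measurableSet_Ioo fun x hx => ?_
    have h := (Real.sqrt_pos.2 (jacobiWeight_pos (α := α) hx)).ne'
    field_simp
  rw [h3] at h2
  refine h1.unique ?_
  refine h2.congr_fun fun n => ?_
  -- The eigenvalue Γ(n + 1 + α)/Γ(n + 1) cancels the Gamma ratio in u_n, leaving the n-th Parseval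
  -- term of ∫κφ.
  rw [integral_jacobiG_mul_rieszFracDeriv hα0 hα1 n hφ, seriesCoeff_eq,
    integral_jacobiUnit_mul_div]
  have g1 : Real.Gamma ((n : ℝ) + 1) ≠ 0 := (Real.Gamma_pos_of_pos (by positivity)).ne'
  have g2 : Real.Gamma ((n : ℝ) + 1 + α) ≠ 0 := (Real.Gamma_pos_of_pos (by positivity)).ne'
  have g3 : Real.Gamma (1 - α) ≠ 0 := (Real.Gamma_pos_of_pos (by linarith)).ne'
  field_simp

theorem IsRieszWeakFracDeriv.integral_eq {a b : ℝ} {u g : ℝ → ℝ} (hα1 : α < 1)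
    (h : IsRieszWeakFracDeriv a b α u g) {φ : ℝ → ℝ} (hφ : IsTestFunction a b φ) :
    ∫ x in Ioo a b, u x * rieszFracDeriv α φ x = ∫ x in Ioo a b, g x * φ x := by
  obtain ⟨v, w, hv, hw, hg⟩ := h
  have hint : ∀ v : ℝ → ℝ, LocallyIntegrableOn v (Ioo a b) →
      IntegrableOn (fun x => v x * φ x) (Ioo a b) := by
    intro v hv
    have h1 : IntegrableOn v (tsupport φ) :=
      hv.integrableOn_compact_subset hφ.support_subset hφ.compact
    have h2 := h1.mul_continuousOn hφ.smooth.continuous.continuousOn hφ.compact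
    refine IntegrableOn.integrable_of_forall_notMem_eq_zero h2 (fun x hx => ?_) |>.integrableOn
    rw [image_eq_zero_of_notMem_tsupport hx, mul_zero]
  rw [integral_mul_rieszFracDeriv_eq_add hα1 hφ hv.integrable, ← hv.integral_eq φ hφ,
    ← hw.integral_eq φ hφ, add_comm, ← integral_add (hint v hv.locallyIntegrable)
    (hint w hw.locallyIntegrable), ← integral_const_mul]
  refine integral_congr_ae ?_
  filter_upwards [hg] with x hx
  rw [hx]; ring

theorem IsRieszHarmonic.exists_representation {u : ℝ → ℝ} (hα : 2 / 3 < α) (hα1 : α < 1)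
    (hu : IsRieszHarmonic 0 1 α u) : ∃ c₁ c₂ d₁ d₂ : ℝ,
      u =ᵐ[volume.restrict (Ioo (0 : ℝ) 1)] fun x => jacobiWeight α x *
        (∑' n : ℕ, seriesCoeff α (rieszNull 0 1 α c₁ c₂) n * jacobiG α n x) +
          rieszNull 0 1 α d₁ d₂ x := by
  have hα0 : 0 < α := by linarith
  obtain ⟨hui, g, hgi, hg, hg0⟩ := hu
  obtain ⟨e₁, e₂, he⟩ := ae_eq_rieszNull_of_integral_mul_rieszFracDeriv_eq_zero hα0 hα1 hgi hg0
  set K := 1 / (2 * Real.Gamma (1 - α)) * potentialConst α with hK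
  have hK0 : K ≠ 0 := mul_ne_zero (one_div_ne_zero (mul_ne_zero two_ne_zero
    (Real.Gamma_pos_of_pos (by linarith)).ne')) (potentialConst_pos hα0 hα1).ne'
  -- The series belonging to κ has Riesz derivative -Kκ, so κ = -g/K makes it equal to g. The
  -- formula for u_n carries no normalizing constant because κ absorbs it.
  have hs := summable_abs_seriesCoeff hα hα1 (-e₁ / K) (-e₂ / K)
  have hSi := integrableOn_jacobiSeries hα0 hs
  obtain ⟨d₁, d₂, hd⟩ := ae_eq_rieszNull_of_integral_mul_rieszFracDeriv_eq_zero hα0 hα1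
    (hui.sub hSi) fun φ hφ => by
      obtain ⟨M, hM⟩ := rieszFracDeriv_bounded hα1 hφ
      have hb : ∀ f : ℝ → ℝ, IntegrableOn f (Ioo 0 1) →
          IntegrableOn (fun x => f x * rieszFracDeriv α φ x) (Ioo 0 1) := fun f hf => by
        refine Integrable.mul_bdd (c := M) hf
          (continuous_rieszFracDeriv hα1 hφ).aestronglyMeasurable ?_
        filter_upwards [ae_restrict_mem measurableSet_Ioo] with x hx using hM x hx
      simp only [Pi.sub_apply, sub_mul]
      rw [integral_sub (hb _ hui) (hb _ hSi),
        integral_jacobiSeries_mul_rieszFracDeriv hα hα1 _ _ hφ, hg.integral_eq hα1 hφ,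
        ← integral_const_mul, sub_eq_zero]
      refine integral_congr_ae ?_
      filter_upwards [he] with x hx
      rw [hx, ← hK, rieszNull, rieszNull]
      field_simp
      ring
  refine ⟨-e₁ / K, -e₂ / K, d₁, d₂, ?_⟩
  filter_upwards [hd] with x hx
  rw [← hx, Pi.sub_apply]
  ring

end Representation

end FracRiesz

end

/-! ### The theorem -/

theorem mainTheorem12 :
    (∀ a b α c₁ c₂ : ℝ, a < b → 0 < α → α < 1 →
      FracRiesz.IsRieszHarmonic a b α (FracRiesz.rieszNull a b α c₁ c₂)) ∧
    (∀ (α : ℝ) (u : ℝ → ℝ), 2 / 3 < α → α < 1 → FracRiesz.IsRieszHarmonic 0 1 α u →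
      ∃ c₁ c₂ d₁ d₂ : ℝ,
        (∀ᵐ x ∂(MeasureTheory.volume.restrict (Set.Ioo (0 : ℝ) 1)),
          Summable (fun n : ℕ =>
            FracRiesz.seriesCoeff α (FracRiesz.rieszNull 0 1 α c₁ c₂) n *
              FracRiesz.jacobiG α n x) ∧
          u x = FracRiesz.jacobiWeight α x *
              (∑' n : ℕ, FracRiesz.seriesCoeff α (FracRiesz.rieszNull 0 1 α c₁ c₂) n *
                FracRiesz.jacobiG α n x) +
            FracRiesz.rieszNull 0 1 α d₁ d₂ x) ∧
        Filter.Tendsto (fun N : ℕ =>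
          ∫⁻ x in Set.Ioo (0 : ℝ) 1, ENNReal.ofReal (FracRiesz.jacobiWeight α x *
            ((∑ n ∈ Finset.range N,
                FracRiesz.seriesCoeff α (FracRiesz.rieszNull 0 1 α c₁ c₂) n *
                  FracRiesz.jacobiG α n x) -
              ∑' n : ℕ, FracRiesz.seriesCoeff α (FracRiesz.rieszNull 0 1 α c₁ c₂) n *
                FracRiesz.jacobiG α n x) ^ 2))
          Filter.atTop (nhds 0)) := by
  refine ⟨fun a b α c₁ c₂ hab hα0 hα => FracRiesz.isRieszHarmonic_rieszNull hab hα0 hα c₁ c₂,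
    fun α u hα hα1 hu => ?_⟩
  have hα0 : 0 < α := by linarith
  obtain ⟨c₁, c₂, d₁, d₂, h⟩ := hu.exists_representation hα hα1
  have hs := FracRiesz.summable_abs_seriesCoeff hα hα1 c₁ c₂
  -- For real series `Summable` is unconditional, hence absolute, convergence; the one estimate `hs`
  -- gives both modes of convergence.
  exact ⟨c₁, c₂, d₁, d₂, (FracRiesz.ae_summable_jacobiSeries hα0 hs).and h,
    FracRiesz.tendsto_lintegral_jacobiSeries hα0 hs⟩
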